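/- Let $H$ be a finite dimensional Hopf algebra over a field $\Bbbk$ with comultiplication $\Delta(h)=h^{(1)}\otimes h^{(2)}$, counit $\varepsilon$ and antipode $\gamma$ (invertible, with inverse $\bar\gamma$). Let $L$ be a base algebra over $H$: a unital left $H$-module algebra and left $H$-comodule algebra, with action $\triangleright$ and coaction $\delta(\lambda)=\lambda^{(1)}\otimes\lambda^{[\infty]}\in H\otimes L$, such that $\delta(h\triangleright\lambda)=h^{(1)}\lambda^{(1)}\gamma(h^{(3)})\otimes h^{(2)}\triangleright\lambda^{[\infty]}$ and $\lambda\mu=(\lambda^{(1)}\triangleright\mu)\lambda^{[\infty]}$ for all $h\in H$, $\lambda,\mu\in L$. Let $A$ be a unital dynamical algebra over $(H,L)$: a left $H$-module with an $H$-equivariant map $\divideontimes\colon A\otimes A\to A\otimes L$ that is shifted associative, i.e. if $a\divideontimes b=\sum_i x_i\otimes\rho_i$ and $b\divideontimes c=\sum_j y_j\otimes\sigma_j$, then $\sum_i(x_i\divideontimes(\rho_i^{(1)}\triangleright c))\,\rho_i^{[\infty]}=\sum_j(a\divideontimes y_j)\,\sigma_j$ for all $a,b,c\in A$ (where $L$ acts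 on $A\otimes L$ by right multiplication on the second factor), and an element $1_A$ with $1_A\divideontimes a=a\divideontimes 1_A=a\otimes 1$ for all $a\in A$. Let $B=A\rtimes L$ be the dynamical smash product: the space $A\otimes L$ with the associative multiplication $(a\otimes\lambda)(b\otimes\mu)=\bigl(a\divideontimes(\lambda^{(1)}\triangleright b)\bigr)(\lambda^{[\infty]}\mu)$; it contains $L=1_A\otimes L$ as a subalgebra and $A=A\otimes 1$ as a subspace. Let $\chi\colon L\to\Bbbk$ be an invariant character, i.e. a unital algebra homomorphism with $\chi(h\triangleright\lambda)=\varepsilon(h)\chi(\lambda)$. For a basis $\{h_i\}$ of $H$ with dual basis $\{\eta^i\}$ define $\tilde\chi\colon L\to\Bbbk$ by $$\tilde\chi(\lambda)=\sum_i\chi\bigl(\eta^i\triangleright(\gamma(h_i)\triangleright\lambda)\bigr),\qquad \eta\triangleright\lambda=\langle\eta,\lambda^{(1)}\rangle\lambda^{[\infty]}.$$ Put $\iota_\chi(\lambda)=\lambda^{(1)}\chi(\lambda^{[\infty]})\in H$ and $A^L_\chi=\{a\in A:\ \iota_\chi(\lambda)\triangleright a=\chi(\lambda)a\ \text{for all }\lambda\in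 L\}$. For a linear functional $\psi$ on $L$ define bilinear operations on $A$ by $$a*_\psi b=\sum_i\psi(\rho_i)x_i,\qquad a\bullet_\psi b=\sum_i\psi(\rho_i^{[\infty]})\,\bar\gamma(\rho_i^{(1)})\triangleright x_i,\qquad\text{where } a\divideontimes b=\sum_i x_i\otimes\rho_i.$$ Then the following hold. 1. $\tilde\chi$ is an invariant character. Let $A_\chi=B\otimes_L\Bbbk_\chi$ be the left $B$-module induced from $\chi$, and let ${}_{\tilde\chi}A=\Bbbk_{\tilde\chi}\otimes_L B$ be the right $B$-module induced from $\tilde\chi$. The maps $A\subset B\to A_\chi$ and $A\subset B\to{}_{\tilde\chi}A$ are bijective. Under these identifications, $a\in A\subset B$ acts on $A_\chi$ by $b\mapsto a*_\chi b$ and on ${}_{\tilde\chi}A$ by $b\mapsto b\bullet_{\tilde\chi}a$. 2. $a*_\chi b=a\bullet_{\tilde\chi}b$ for all $a,b\in A^L_\chi$. 3. $A^L_\chi$ is an $H$-submodule of $A$ containing $1_A$ and closed under $*_\chi$, and $(A^L_\chi,*_\chi,1_A)$ is an associative unital $H$-module algebra. 4. $A$ is a right $A^L_\chi$-module under $*_\chi$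 and a left $A^L_\chi$-module under $\bullet_{\tilde\chi}$. 5. There are isomorphisms of $\Bbbk$-algebras $$\mathrm{End}_B(A_\chi)\simeq(A^L_\chi)^{op}\simeq\mathrm{End}_B({}_{\tilde\chi}A)^{op}.$$ Here both endomorphism algebras have the multiplication $fg=f\circ g$, and $c\in A^L_\chi$ corresponds to the endomorphism $a\mapsto a*_\chi c$ of $A_\chi$ and to the endomorphism $a\mapsto c\bullet_{\tilde\chi}a$ of ${}_{\tilde\chi}A$. Equivalently, the second isomorphism says that $(A^L_\chi)^{op}$ is the algebra of endomorphisms of the right module ${}_{\tilde\chi}A$ when these are multiplied as right operators, i.e. $fg=g\circ f$. -/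

import Mathlib

open scoped TensorProduct

noncomputable section

namespace DynBase

universe u v w x y

section HopfActions

variable (k : Type u) (H : Type v) [Field k] [Ring H] [HopfAlgebra k H]

/-- The action map of a left `H`-module `M`, as an algebra homomorphism `H → End_k M`. -/
abbrev act (M : Type w) [AddCommGroup M] [Module k M] [Module H M] [IsScalarTower k H M] :
    H →ₐ[k] Module.End k M :=
  Algebra.lsmul k k M

/-- The diagonal action of `H` on `M ⊗ N`: `h ▷ (m ⊗ n) = h⁽¹⁾ ▷ m ⊗ h⁽²⁾ ▷ n`. -/
def diagAct (M : Type w) [AddCommGroup M] [Module k M] [Module H M] [IsScalarTower k H M]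
    (N : Type x) [AddCommGroup N] [Module k N] [Module H N] [IsScalarTower k H N] :
    H →ₗ[k] Module.End k (M ⊗[k] N) :=
  TensorProduct.homTensorHomMap (RingHom.id k) M N M N ∘ₗ
    TensorProduct.map (act k H M).toLinearMap (act k H N).toLinearMap ∘ₗ
    Coalgebra.comul

/-- The inverse `γ̄` of the antipode `γ` of a finite dimensional Hopf algebra (`γ` is a bijective
linear map there, so that `Ring.inverse`, taken in the ring `End_k H`, is its inverse). -/
def antipodeInv : H →ₗ[k] H :=
  Ring.inverse (M₀ := Module.End k H) (HopfAlgebra.antipode k)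

/-- `h ↦ (x ⊗ m ↦ h⁽¹⁾ x γ(h⁽³⁾) ⊗ h⁽²⁾ ▷ m)`, the operator on `H ⊗ M` that occurs in the
Yetter-Drinfeld condition. -/
def ydAct (M : Type w) [AddCommGroup M] [Module k M] [Module H M] [IsScalarTower k H M] :
    H →ₗ[k] Module.End k (H ⊗[k] M) :=
  (TensorProduct.lift
    ((LinearMap.mul k (Module.End k (H ⊗[k] M))).compl₁₂
      -- `a ↦ (x ⊗ m ↦ a x ⊗ m)`
      (LinearMap.rTensorHom M ∘ₗ LinearMap.mul k H)
      -- `b ⊗ c ↦ (x ⊗ m ↦ x γ(c) ⊗ b ▷ m)`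
      (TensorProduct.homTensorHomMap (RingHom.id k) H M H M ∘ₗ
        TensorProduct.map ((LinearMap.mul k H).flip ∘ₗ HopfAlgebra.antipode k)
          (act k H M).toLinearMap ∘ₗ
        (TensorProduct.comm k H H).toLinearMap))) ∘ₗ
    LinearMap.lTensor H Coalgebra.comul ∘ₗ Coalgebra.comul

end HopfActions

/-- A dynamical base `(H, L)`: the `k`-algebra `L`, with its left `H`-module structure, is a
unital left `H`-module algebra and a left `H`-comodule algebra, the action and the coaction obey
the Yetter-Drinfeld condition, and `L` is braided commutative. -/
structure Base (k : Type u) (H : Type v) (L : Type w) [Field k] [Ring H] [HopfAlgebra k H]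
    [Ring L] [Algebra k L] [Module H L] [IsScalarTower k H L] where
  /-- the coaction `δ(l) = l⁽¹⁾ ⊗ l^[∞]`, an algebra homomorphism -/
  coact : L →ₐ[k] H ⊗[k] L
  smul_one : ∀ h : H, h • (1 : L) = Coalgebra.counit (R := k) h • (1 : L)
  smul_mul : ∀ (h : H) (l m : L),
    h • (l * m) = LinearMap.mul' k L (diagAct k H L L h (l ⊗ₜ[k] m))
  counit_coact : ∀ l : L,
    TensorProduct.lid k L (LinearMap.rTensor L Coalgebra.counit (coact l)) = l
  coassoc : ∀ l : L,
    TensorProduct.assoc k H H L (LinearMap.rTensor L Coalgebra.comul (coact l)) =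
      LinearMap.lTensor H coact.toLinearMap (coact l)
  /-- `δ(h ▷ l) = h⁽¹⁾ l⁽¹⁾ γ(h⁽³⁾) ⊗ h⁽²⁾ ▷ l^[∞]` -/
  yetterDrinfeld : ∀ (h : H) (l : L), coact (h • l) = ydAct k H L h (coact l)
  /-- `l m = (l⁽¹⁾ ▷ m) l^[∞]` -/
  braided_comm : ∀ l m : L,
    l * m = LinearMap.mul' k L
      (LinearMap.rTensor L ((act k H L).toLinearMap.flip m) (coact l))

namespace Base

variable {k : Type u} {H : Type v} {L : Type w} [Field k] [Ring H] [HopfAlgebra k H]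
  [Ring L] [Algebra k L] [Module H L] [IsScalarTower k H L] (D : Base k H L)

/-- The permutation `τ_M : L ⊗ M → M ⊗ L`, `l ⊗ m ↦ l⁽¹⁾ ▷ m ⊗ l^[∞]`. -/
def braid (M : Type x) [AddCommGroup M] [Module k M] [Module H M] [IsScalarTower k H M] :
    L ⊗[k] M →ₗ[k] M ⊗[k] L :=
  LinearMap.rTensor L (TensorProduct.lift (act k H M).toLinearMap) ∘ₗ
    (TensorProduct.rightComm k H L M).toLinearMap ∘ₗ
    LinearMap.rTensor M D.coact.toLinearMap

/-- Invariant characters of the base algebra: unital algebra homomorphisms `χ : L → k` with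
`χ(h ▷ l) = ε(h) χ(l)`. -/
structure IsInvariantCharacter (_D : Base k H L) (χ : L →ₗ[k] k) : Prop where
  map_one : χ 1 = 1
  map_mul : ∀ l m : L, χ (l * m) = χ l * χ m
  invariant : ∀ (h : H) (l : L), χ (h • l) = Coalgebra.counit (R := k) h * χ l

/-- `ι_χ : L → H`, `l ↦ l⁽¹⁾ χ(l^[∞])`. -/
def iota (χ : L →ₗ[k] k) : L →ₗ[k] H :=
  (TensorProduct.rid k H).toLinearMap ∘ₗ LinearMap.lTensor H χ ∘ₗ D.coact.toLinearMap

/-- The space `V[χ]` of `χ`-generators of a left `H`-module `V`: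
all `v` with `ι_χ(l) ▷ v = χ(l) v` for every `l` in `L`. -/
def generators (χ : L →ₗ[k] k) (V : Type x) [AddCommGroup V] [Module k V] [Module H V]
    [IsScalarTower k H V] : Submodule k V where
  carrier := {v | ∀ l : L, D.iota χ l • v = χ l • v}
  zero_mem' := by intro l; simp
  add_mem' := by intro a b ha hb l; rw [smul_add, smul_add, ha l, hb l]
  smul_mem' := by intro c a ha l; rw [smul_comm, ha l, smul_comm]

/-- The action of `η ∈ H*` on `L` dual to the coaction: `η ▷ l = ⟨η, l⁽¹⁾⟩ l^[∞]`. Together with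
the action of `H` it makes `L` a module over the double `H ⋈ H*_op`. -/
def dualAct (η : Module.Dual k H) : L →ₗ[k] L :=
  (TensorProduct.lid k L).toLinearMap ∘ₗ LinearMap.rTensor L η ∘ₗ D.coact.toLinearMap

/-- The action on `L` of the element `ϑ̄ = Θ₁ γ(Θ₂) = ∑ᵢ ηⁱ γ(hᵢ)` of the double of `H`, where
`Θ = ∑ᵢ ηⁱ ⊗ hᵢ` is the canonical element of a basis `hᵢ` of `H` and its dual basis `ηⁱ`. -/
def drinfeldInv [FiniteDimensional k H] : L →ₗ[k] L :=
  ∑ i, D.dualAct ((Module.finBasis k H).coord i) ∘ₗ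
    act k H L (HopfAlgebra.antipode k (Module.finBasis k H i))

/-- The adjoint character `χ̃(l) = χ(ϑ̄ ▷ l)`. -/
def adjointChar [FiniteDimensional k H] (χ : L →ₗ[k] k) : L →ₗ[k] k :=
  χ ∘ₗ D.drinfeldInv

end Base

section Absorb

variable (k : Type u) (L : Type w) [Field k] [Ring L] [Algebra k L]

/-- `(a ⊗ l) ⊗ m ↦ a ⊗ l m`. -/
def absorb (A : Type x) [AddCommGroup A] [Module k A] :
    (A ⊗[k] L) ⊗[k] L →ₗ[k] A ⊗[k] L :=
  LinearMap.lTensor A (LinearMap.mul' k L) ∘ₗ (TensorProduct.assoc k A L L).toLinearMap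

@[simp] lemma absorb_tmul (A : Type x) [AddCommGroup A] [Module k A] (a : A) (l m : L) :
    absorb k L A ((a ⊗ₜ l) ⊗ₜ m) = a ⊗ₜ (l * m) := by
  simp [absorb]

end Absorb

/-- A unital dynamical algebra `A` over the base `(H, L)`: a left `H`-module with an equivariant
multiplication `A ⊗ A → A ⊗ L`, shifted associative, with a two-sided unit. -/
structure DynAlgebra {k : Type u} {H : Type v} {L : Type w} [Field k] [Ring H] [HopfAlgebra k H]
    [Ring L] [Algebra k L] [Module H L] [IsScalarTower k H L] (D : Base k H L)
    (A : Type x) [AddCommGroup A] [Module k A] [Module H A] [IsScalarTower k H A] where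
  /-- the dynamical multiplication -/
  mul : A ⊗[k] A →ₗ[k] A ⊗[k] L
  equivariant : ∀ (h : H) (t : A ⊗[k] A), mul (diagAct k H A A h t) = diagAct k H A L h (mul t)
  /-- `(A ⊗ A) ⊗ A → (A ⊗ L) ⊗ A → A ⊗ A ⊗ L → A ⊗ L ⊗ L → A ⊗ L` agrees with
  `A ⊗ (A ⊗ A) → A ⊗ A ⊗ L → A ⊗ L ⊗ L → A ⊗ L`. -/
  shifted_assoc : ∀ a b c : A,
    absorb k L A (LinearMap.rTensor L mul ((TensorProduct.assoc k A A L).symm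
      (LinearMap.lTensor A (D.braid A) (TensorProduct.assoc k A L A (mul (a ⊗ₜ b) ⊗ₜ c))))) =
    absorb k L A (LinearMap.rTensor L mul ((TensorProduct.assoc k A A L).symm
      (a ⊗ₜ mul (b ⊗ₜ c))))
  /-- the unit `1_A` -/
  one : A
  one_mul : ∀ a : A, mul (one ⊗ₜ a) = a ⊗ₜ 1
  mul_one : ∀ a : A, mul (a ⊗ₜ one) = a ⊗ₜ 1

namespace DynAlgebra

variable {k : Type u} {H : Type v} {L : Type w} [Field k] [Ring H] [HopfAlgebra k H]
  [Ring L] [Algebra k L] [Module H L] [IsScalarTower k H L] {D : Base k H L}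
  {A : Type x} [AddCommGroup A] [Module k A] [Module H A] [IsScalarTower k H A]
  (𝒜 : DynAlgebra D A)

/-- `b ⊗ m ↦ (a ⋇ b) m`, for `a ∈ A`. -/
def leftA : A →ₗ[k] Module.End k (A ⊗[k] L) :=
  (LinearMap.llcomp k ((A ⊗[k] L)) ((A ⊗[k] L) ⊗[k] L) (A ⊗[k] L) (absorb k L A)) ∘ₗ
    LinearMap.rTensorHom L ∘ₗ TensorProduct.curry 𝒜.mul

/-- `b ⊗ m ↦ (l⁽¹⁾ ▷ b) ⊗ l^[∞] m`, for `l ∈ L`. -/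
def leftL (_𝒜 : DynAlgebra D A) : L →ₗ[k] Module.End k (A ⊗[k] L) :=
  (LinearMap.llcomp k ((A ⊗[k] L)) ((A ⊗[k] L) ⊗[k] L) (A ⊗[k] L) (absorb k L A)) ∘ₗ
    LinearMap.rTensorHom L ∘ₗ TensorProduct.curry (D.braid A)

/-- The multiplication `(a ⊗ l)(b ⊗ m) = (a ⋇ (l⁽¹⁾ ▷ b)) (l^[∞] m)` on `A ⊗ L`. -/
def smashMul : A ⊗[k] L →ₗ[k] Module.End k (A ⊗[k] L) :=
  TensorProduct.lift
    ((LinearMap.mul k (Module.End k (A ⊗[k] L))).compl₁₂ 𝒜.leftA 𝒜.leftL)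

lemma absorb_one (t : A ⊗[k] L) : absorb k L A (t ⊗ₜ 1) = t := by
  induction t with
  | zero => simp
  | tmul a l => simp
  | add x y hx hy => rw [TensorProduct.add_tmul, map_add, hx, hy]

lemma absorb_absorb (t : A ⊗[k] L) (m n : L) :
    absorb k L A (absorb k L A (t ⊗ₜ m) ⊗ₜ n) = absorb k L A (t ⊗ₜ (m * n)) := by
  induction t with
  | zero => simp
  | tmul a l => simp [mul_assoc]
  | add x y hx hy => simp only [TensorProduct.add_tmul, map_add, hx, hy]

lemma leftA_tmul (a b : A) (m : L) :
    𝒜.leftA a (b ⊗ₜ m) = absorb k L A (𝒜.mul (a ⊗ₜ b) ⊗ₜ m) := by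
  simp [leftA]

lemma leftL_tmul (l : L) (b : A) (m : L) :
    𝒜.leftL l (b ⊗ₜ m) = absorb k L A (D.braid A (l ⊗ₜ b) ⊗ₜ m) := by
  simp [leftL]

lemma leftA_absorb (a : A) (t : A ⊗[k] L) (m : L) :
    𝒜.leftA a (absorb k L A (t ⊗ₜ m)) = absorb k L A (𝒜.leftA a t ⊗ₜ m) := by
  induction t with
  | zero => simp
  | tmul b l => simp [leftA_tmul, absorb_absorb]
  | add x y hx hy => simp only [TensorProduct.add_tmul, map_add, hx, hy]

lemma leftL_absorb (l : L) (t : A ⊗[k] L) (m : L) :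
    𝒜.leftL l (absorb k L A (t ⊗ₜ m)) = absorb k L A (𝒜.leftL l t ⊗ₜ m) := by
  induction t with
  | zero => simp
  | tmul b n => simp [leftL_tmul, absorb_absorb]
  | add x y hx hy => simp only [TensorProduct.add_tmul, map_add, hx, hy]

lemma smashMul_tmul (a : A) (l : L) : 𝒜.smashMul (a ⊗ₜ l) = 𝒜.leftA a * 𝒜.leftL l := by
  simp [smashMul]

lemma smashMul_absorb_right (s t : A ⊗[k] L) (m : L) :
    𝒜.smashMul s (absorb k L A (t ⊗ₜ m)) = absorb k L A (𝒜.smashMul s t ⊗ₜ m) := by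
  induction s with
  | zero => simp
  | tmul a l => simp [smashMul_tmul, leftA_absorb, leftL_absorb]
  | add x y hx hy => simp only [TensorProduct.add_tmul, map_add, LinearMap.add_apply, hx, hy]

lemma ext_of_absorb {F G : Module.End k (A ⊗[k] L)}
    (hF : ∀ t m, F (absorb k L A (t ⊗ₜ m)) = absorb k L A (F t ⊗ₜ m))
    (hG : ∀ t m, G (absorb k L A (t ⊗ₜ m)) = absorb k L A (G t ⊗ₜ m))
    (h : ∀ c : A, F (c ⊗ₜ 1) = G (c ⊗ₜ 1)) : F = G := by
  apply TensorProduct.ext'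
  intro c m
  have : (c ⊗ₜ[k] m : A ⊗[k] L) = absorb k L A ((c ⊗ₜ 1) ⊗ₜ m) := by simp
  rw [this, hF, hG, h]

lemma braid_eq (l : L) (b : A) :
    D.braid A (l ⊗ₜ b) = LinearMap.rTensor L ((act k H A).toLinearMap.flip b) (D.coact l) := by
  simp only [Base.braid, LinearMap.comp_apply, LinearMap.rTensor_tmul, AlgHom.toLinearMap_apply,
    LinearEquiv.coe_coe]
  induction D.coact l with
  | zero => simp
  | tmul h n => simp
  | add x y hx hy => simp only [TensorProduct.add_tmul, map_add, hx, hy]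

lemma leftL_one' (l : L) (b : A) :
    𝒜.leftL l (b ⊗ₜ 1) = LinearMap.rTensor L ((act k H A).toLinearMap.flip b) (D.coact l) := by
  rw [leftL_tmul, absorb_one, braid_eq]

lemma leftL_mul (l m : L) : 𝒜.leftL (l * m) = 𝒜.leftL l * 𝒜.leftL m := by
  refine ext_of_absorb (leftL_absorb 𝒜 _) (fun t n => by simp [leftL_absorb]) fun b => ?_
  rw [Module.End.mul_apply, leftL_one', leftL_one', map_mul]
  induction D.coact m with
  | zero => simp
  | add x y hx hy => simp only [mul_add, map_add, hx, hy]
  | tmul h n =>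
    simp only [LinearMap.rTensor_tmul, leftL_tmul, braid_eq]
    induction D.coact l with
    | zero => simp
    | add x y hx hy => simp only [add_mul, map_add, TensorProduct.add_tmul, hx, hy]
    | tmul h' n' => simp

lemma smashMul_mul_eq (a b : A) : 𝒜.smashMul (𝒜.mul (a ⊗ₜ b)) = 𝒜.leftA a * 𝒜.leftA b := by
  refine ext_of_absorb (smashMul_absorb_right 𝒜 _) (fun t n => by simp [leftA_absorb]) fun c => ?_
  have h := 𝒜.shifted_assoc a b c
  rw [Module.End.mul_apply, leftA_tmul, absorb_one]
  trans absorb k L A (LinearMap.rTensor L 𝒜.mul ((TensorProduct.assoc k A A L).symm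
      (a ⊗ₜ 𝒜.mul (b ⊗ₜ c))))
  · rw [← h]
    induction 𝒜.mul (a ⊗ₜ b) with
    | zero => simp
    | add x y hx hy => simp only [map_add, TensorProduct.add_tmul, LinearMap.add_apply, hx, hy]
    | tmul x l =>
      simp only [smashMul_tmul, Module.End.mul_apply, leftL_tmul, absorb_one,
        TensorProduct.assoc_tmul, LinearMap.lTensor_tmul]
      induction D.braid A (l ⊗ₜ c) with
      | zero => simp
      | add x y hx hy => simp only [map_add, TensorProduct.tmul_add, hx, hy]
      | tmul y m => simp [leftA_tmul]
  · induction 𝒜.mul (b ⊗ₜ c) with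
    | zero => simp
    | add x y hx hy => simp only [map_add, TensorProduct.tmul_add, hx, hy]
    | tmul y m => simp [leftA_tmul]

lemma diagAct_eq (M : Type x) [AddCommGroup M] [Module k M] [Module H M] [IsScalarTower k H M]
    (N : Type y) [AddCommGroup N] [Module k N] [Module H N] [IsScalarTower k H N]
    (h : H) (m : M) (n : N) :
    diagAct k H M N h (m ⊗ₜ n) = TensorProduct.map ((act k H M).toLinearMap.flip m)
      ((act k H N).toLinearMap.flip n) (Coalgebra.comul (R := k) h) := by
  simp only [diagAct, LinearMap.comp_apply]
  induction Coalgebra.comul (R := k) h with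
  | zero => simp
  | add x y hx hy => simp only [map_add, LinearMap.add_apply, hx, hy]
  | tmul y m => simp [TensorProduct.homTensorHomMap_apply]

/-- `l · (x ⊗ r) = (l⁽¹⁾ ▷ (x ⊗ r)) l^[∞]`, by braided commutativity. -/
lemma leftL_eq_diag (l : L) (t : A ⊗[k] L) :
    𝒜.leftL l t = absorb k L A (LinearMap.rTensor L ((diagAct k H A L).flip t) (D.coact l)) := by
  induction t with
  | zero => simp
  | add x y hx hy => simp only [map_add, LinearMap.rTensor_add, LinearMap.add_apply, hx, hy]
  | tmul x r =>
    -- `(g ⊗ g') ⊗ n ↦ g ▷ x ⊗ (g' ▷ r) n`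
    let K : (H ⊗[k] H) ⊗[k] L →ₗ[k] A ⊗[k] L :=
      absorb k L A ∘ₗ LinearMap.rTensor L (TensorProduct.map ((act k H A).toLinearMap.flip x)
        ((act k H L).toLinearMap.flip r))
    have h1 : ∀ s : H ⊗[k] L,
        absorb k L A (LinearMap.rTensor L ((diagAct k H A L).flip (x ⊗ₜ r)) s) =
        K (LinearMap.rTensor L Coalgebra.comul s) := by
      intro s
      induction s with
      | zero => simp
      | add x y hx hy => simp only [map_add, hx, hy]
      | tmul h n => simp [K, diagAct_eq]
    have h2 : ∀ s : H ⊗[k] L,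
        K ((TensorProduct.assoc k H H L).symm (LinearMap.lTensor H D.coact.toLinearMap s)) =
        absorb k L A (LinearMap.rTensor L ((act k H A).toLinearMap.flip x) s ⊗ₜ r) := by
      intro s
      induction s with
      | zero => simp
      | add x y hx hy => simp only [map_add, TensorProduct.add_tmul, hx, hy]
      | tmul h n =>
        simp only [LinearMap.rTensor_tmul, LinearMap.lTensor_tmul, AlgHom.toLinearMap_apply]
        trans (h • x) ⊗ₜ[k] (LinearMap.mul' k L
          (LinearMap.rTensor L ((act k H L).toLinearMap.flip r) (D.coact n)))
        · induction D.coact n with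
          | zero => simp
          | add x y hx hy => simp only [map_add, TensorProduct.tmul_add, hx, hy]
          | tmul h' n' => simp [K]
        · rw [← D.braided_comm]
          simp
    rw [h1, leftL_tmul, braid_eq, ← h2, ← D.coassoc, LinearEquiv.symm_apply_apply]

lemma smashMul_braid (l : L) (b : A) :
    𝒜.smashMul (D.braid A (l ⊗ₜ b)) = 𝒜.leftL l * 𝒜.leftA b := by
  refine ext_of_absorb (smashMul_absorb_right 𝒜 _)
    (fun t n => by simp [leftA_absorb, leftL_absorb]) fun c => ?_
  rw [Module.End.mul_apply, leftA_tmul, absorb_one, leftL_eq_diag, braid_eq]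
  -- `g ⊗ (g' ⊗ n) ↦ ((g ▷ b) ⋇ (g' ▷ c)) n`
  let K : (H ⊗[k] H) ⊗[k] L →ₗ[k] A ⊗[k] L :=
    absorb k L A ∘ₗ LinearMap.rTensor L (𝒜.mul ∘ₗ
      TensorProduct.map ((act k H A).toLinearMap.flip b) ((act k H A).toLinearMap.flip c))
  have h1 : ∀ s : H ⊗[k] L,
      absorb k L A (LinearMap.rTensor L ((diagAct k H A L).flip (𝒜.mul (b ⊗ₜ c))) s) =
      K (LinearMap.rTensor L Coalgebra.comul s) := by
    intro s
    induction s with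
    | zero => simp
    | add x y hx hy => simp only [map_add, hx, hy]
    | tmul h n => simp [K, ← 𝒜.equivariant, diagAct_eq]
  have h2 : ∀ s : H ⊗[k] L,
      K ((TensorProduct.assoc k H H L).symm (LinearMap.lTensor H D.coact.toLinearMap s)) =
      𝒜.smashMul (LinearMap.rTensor L ((act k H A).toLinearMap.flip b) s) (c ⊗ₜ 1) := by
    intro s
    induction s with
    | zero => simp
    | add x y hx hy => simp only [map_add, LinearMap.add_apply, hx, hy]
    | tmul h n =>
      simp only [LinearMap.rTensor_tmul, LinearMap.lTensor_tmul, AlgHom.toLinearMap_apply,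
        smashMul_tmul, Module.End.mul_apply, leftL_one']
      induction D.coact n with
      | zero => simp
      | add x y hx hy => simp only [map_add, TensorProduct.tmul_add, hx, hy]
      | tmul h' n' => simp [K, leftA_tmul]
  rw [h1, ← h2, ← D.coassoc, LinearEquiv.symm_apply_apply]

lemma smashMul_assoc (s t : A ⊗[k] L) :
    𝒜.smashMul (𝒜.smashMul s t) = 𝒜.smashMul s * 𝒜.smashMul t := by
  have hA : ∀ (x : A ⊗[k] L) (m : L),
      𝒜.smashMul (absorb k L A (x ⊗ₜ m)) = 𝒜.smashMul x * 𝒜.leftL m := by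
    intro x m
    induction x with
    | zero => simp
    | add x y hx hy => simp only [map_add, TensorProduct.add_tmul, add_mul, hx, hy]
    | tmul a l => simp [smashMul_tmul, leftL_mul, mul_assoc]
  have hl : ∀ (l : L) (x : A ⊗[k] L), 𝒜.smashMul (𝒜.leftL l x) = 𝒜.leftL l * 𝒜.smashMul x := by
    intro l x
    induction x with
    | zero => simp
    | add x y hx hy => simp only [map_add, mul_add, hx, hy]
    | tmul b m => rw [leftL_tmul, hA, smashMul_braid, smashMul_tmul, mul_assoc]
  have ha : ∀ (a : A) (x : A ⊗[k] L), 𝒜.smashMul (𝒜.leftA a x) = 𝒜.leftA a * 𝒜.smashMul x := by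
    intro a x
    induction x with
    | zero => simp
    | add x y hx hy => simp only [map_add, mul_add, hx, hy]
    | tmul b m => rw [leftA_tmul, hA, smashMul_mul_eq, smashMul_tmul, mul_assoc]
  induction s with
  | zero => simp
  | add x y hx hy => simp only [map_add, LinearMap.add_apply, add_mul, hx, hy]
  | tmul a l => rw [smashMul_tmul, Module.End.mul_apply, ha, hl, mul_assoc]

lemma smashMul_one_left : 𝒜.smashMul (𝒜.one ⊗ₜ 1) = 1 := by
  refine ext_of_absorb (smashMul_absorb_right 𝒜 _) (fun t n => rfl) fun c => ?_
  rw [smashMul_tmul, Module.End.mul_apply, leftL_one', map_one, Algebra.TensorProduct.one_def]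
  simp [leftA_tmul, 𝒜.one_mul]

/-- The unit of a dynamical algebra is `H`-invariant. -/
lemma smul_one_tmul (h : H) :
    (h • 𝒜.one) ⊗ₜ[k] (1 : L) = (Coalgebra.counit (R := k) h • 𝒜.one) ⊗ₜ (1 : L) := by
  -- `g ⊗ g' ↦ (g ▷ 1) ⋇ (g' ▷ a)` at `h⁽¹⁾ ⊗ h⁽²⁾` is `h ▷ a ⊗ 1`
  have h1 : ∀ (g : H) (a : A), 𝒜.mul (TensorProduct.map ((act k H A).toLinearMap.flip 𝒜.one)
      ((act k H A).toLinearMap.flip a) (Coalgebra.comul (R := k) g)) = (g • a) ⊗ₜ 1 := by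
    intro g a
    have := 𝒜.equivariant g (𝒜.one ⊗ₜ a)
    rw [diagAct_eq, 𝒜.one_mul, diagAct_eq] at this
    rw [this]
    have h2 : TensorProduct.map ((act k H A).toLinearMap.flip a)
        ((act k H L).toLinearMap.flip (1 : L)) =
        LinearMap.lTensor A (LinearMap.toSpanSingleton k L 1) ∘ₗ
        LinearMap.rTensor k ((act k H A).toLinearMap.flip a) ∘ₗ
        LinearMap.lTensor H Coalgebra.counit := by
      apply TensorProduct.ext'
      intro x y
      simp [D.smul_one]
    rw [h2, LinearMap.comp_apply, LinearMap.comp_apply, Coalgebra.lTensor_counit_comul]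
    simp
  -- `g ⊗ (g' ⊗ g'') ↦ (g ▷ 1) ⋇ (g' γ(g'') ▷ 1)`
  let J : H ⊗[k] H →ₗ[k] A ⊗[k] L := 𝒜.mul ∘ₗ TensorProduct.map
    ((act k H A).toLinearMap.flip 𝒜.one) ((act k H A).toLinearMap.flip 𝒜.one)
  let K : H ⊗[k] (H ⊗[k] H) →ₗ[k] A ⊗[k] L := J ∘ₗ LinearMap.lTensor H
    (LinearMap.mul' k H ∘ₗ LinearMap.lTensor H (HopfAlgebra.antipode k))
  have hK1 : K (LinearMap.lTensor H Coalgebra.comul (Coalgebra.comul (R := k) h)) =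
      (h • 𝒜.one) ⊗ₜ (1 : L) := by
    have : K ∘ₗ LinearMap.lTensor H Coalgebra.comul = J ∘ₗ LinearMap.lTensor H
        (Algebra.linearMap k H ∘ₗ Coalgebra.counit) := by
      rw [← HopfAlgebra.mul_antipode_lTensor_comul]
      simp only [K, LinearMap.comp_assoc, ← LinearMap.lTensor_comp]
    rw [← LinearMap.comp_apply, this, LinearMap.lTensor_comp, LinearMap.comp_apply,
      LinearMap.comp_apply, LinearMap.comp_apply, Coalgebra.lTensor_counit_comul]
    simp [𝒜.mul_one]
  have hK2 : K (LinearMap.lTensor H Coalgebra.comul (Coalgebra.comul (R := k) h)) =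
      (Coalgebra.counit (R := k) h • 𝒜.one) ⊗ₜ (1 : L) := by
    rw [← Coalgebra.coassoc_apply]
    have h3 : ∀ s : H ⊗[k] H, K (TensorProduct.assoc k H H H
        (LinearMap.rTensor H Coalgebra.comul s)) =
        (LinearMap.mul' k H (LinearMap.lTensor H (HopfAlgebra.antipode k) s) • 𝒜.one) ⊗ₜ
          (1 : L) := by
      intro s
      induction s with
      | zero => simp
      | add x y hx hy => simp only [map_add, add_smul, TensorProduct.add_tmul, hx, hy]
      | tmul g g' =>
        have h4 := h1 g (HopfAlgebra.antipode k g' • 𝒜.one)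
        simp only [LinearMap.rTensor_tmul, LinearMap.lTensor_tmul, LinearMap.mul'_apply, mul_smul]
        rw [← h4]
        induction Coalgebra.comul (R := k) g with
        | zero => simp
        | add x y hx hy => simp only [map_add, TensorProduct.add_tmul, hx, hy]
        | tmul u v => simp [K, J]
    rw [h3, HopfAlgebra.mul_antipode_lTensor_comul_apply, algebraMap_smul]
  rw [← hK1, hK2]

lemma smashMul_one_right (s : A ⊗[k] L) : 𝒜.smashMul s (𝒜.one ⊗ₜ 1) = s := by
  induction s with
  | zero => simp
  | add x y hx hy => simp only [map_add, LinearMap.add_apply, hx, hy]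
  | tmul a l =>
    have h1 : 𝒜.leftL l (𝒜.one ⊗ₜ 1) = 𝒜.one ⊗ₜ l := by
      have h2 : ∀ s : H ⊗[k] L,
          LinearMap.rTensor L ((act k H A).toLinearMap.flip 𝒜.one) s =
          𝒜.one ⊗ₜ TensorProduct.lid k L (LinearMap.rTensor L Coalgebra.counit s) := by
        intro s
        induction s with
        | zero => simp
        | add x y hx hy => simp only [map_add, TensorProduct.tmul_add, hx, hy]
        | tmul h n =>
          have h3 := congrArg (fun z => absorb k L A (z ⊗ₜ n)) (𝒜.smul_one_tmul h)
          simpa [TensorProduct.smul_tmul] using h3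
      rw [leftL_one', h2, D.counit_coact]
    rw [smashMul_tmul, Module.End.mul_apply, h1, leftA_tmul, 𝒜.mul_one, absorb_tmul, _root_.one_mul]

/-- The dynamical smash product `B = A ⋊ L`: the vector space `A ⊗ L` with multiplication
`(a ⊗ l)(b ⊗ m) = (a ⋇ (l⁽¹⁾ ▷ b)) (l^[∞] m)`. -/
def Smash (_𝒜 : DynAlgebra D A) : Type _ := A ⊗[k] L

namespace Smash

instance : AddCommGroup 𝒜.Smash := inferInstanceAs (AddCommGroup (A ⊗[k] L))
instance : Module k 𝒜.Smash := inferInstanceAs (Module k (A ⊗[k] L))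

instance : Ring 𝒜.Smash :=
  { (inferInstance : AddCommGroup 𝒜.Smash) with
    mul := fun s t => 𝒜.smashMul s t
    one := 𝒜.one ⊗ₜ 1
    mul_assoc := fun s t u => LinearMap.congr_fun (𝒜.smashMul_assoc s t) u
    one_mul := fun s => LinearMap.congr_fun 𝒜.smashMul_one_left s
    mul_one := 𝒜.smashMul_one_right
    left_distrib := fun s t u => map_add (𝒜.smashMul s) t u
    right_distrib := fun s t u => LinearMap.congr_fun (map_add 𝒜.smashMul s t) u
    zero_mul := fun s => LinearMap.congr_fun (map_zero 𝒜.smashMul) s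
    mul_zero := fun s => map_zero (𝒜.smashMul s) }

instance : Algebra k 𝒜.Smash :=
  Algebra.ofModule (fun c s t => LinearMap.congr_fun (map_smul 𝒜.smashMul c s) t)
    (fun c s t => map_smul (𝒜.smashMul s) c t)

/-- The element `a ⊗ l` of `A ⋊ L`. -/
def mk (a : A) (l : L) : 𝒜.Smash := a ⊗ₜ[k] l

end Smash

/-- `a ∗_χ b = (id ⊗ χ)(a ⋇ b)`. -/
def star (χ : L →ₗ[k] k) : A →ₗ[k] A →ₗ[k] A :=
  TensorProduct.curry ((TensorProduct.rid k A).toLinearMap ∘ₗ LinearMap.lTensor A χ ∘ₗ 𝒜.mul)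

/-- The passage `A ⊗ L → L ⊗ A`, `a ⊗ l ↦ l^[∞] ⊗ (γ̄(l⁽¹⁾) ▷ a)`, from the factorization
`B = A L` to the factorization `B = L A`. -/
def toLA (_𝒜 : DynAlgebra D A) : A ⊗[k] L →ₗ[k] L ⊗[k] A :=
  (TensorProduct.comm k A L).toLinearMap ∘ₗ
    LinearMap.rTensor L (TensorProduct.lift ((act k H A).toLinearMap ∘ₗ antipodeInv k H)) ∘ₗ
    (TensorProduct.rightComm k H L A).toLinearMap ∘ₗ
    LinearMap.rTensor A D.coact.toLinearMap ∘ₗ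
    (TensorProduct.comm k A L).toLinearMap

/-- `a •_χ b = χ(ℓ) c`, where `a ⋇ b = ℓ c` with `ℓ` in `L` and `c` in `A` (summation implied). -/
def rdot (χ : L →ₗ[k] k) : A →ₗ[k] A →ₗ[k] A :=
  TensorProduct.curry ((TensorProduct.lid k A).toLinearMap ∘ₗ LinearMap.rTensor A χ ∘ₗ
    𝒜.toLA ∘ₗ 𝒜.mul)

/-- The left `B`-module `A_χ = B ⊗_L k_χ = B / B {l - χ(l)}` induced from `χ`. -/
abbrev LeftInduced (χ : L →ₗ[k] k) : Type _ :=
  𝒜.Smash ⧸ (Submodule.span 𝒜.Smash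
    (Set.range fun l : L => Smash.mk 𝒜 𝒜.one l - χ l • (1 : 𝒜.Smash)))

/-- The class of `a ∈ A ⊂ B` in `A_χ`. -/
def toLeft (χ : L →ₗ[k] k) (a : A) : 𝒜.LeftInduced χ := Submodule.Quotient.mk (Smash.mk 𝒜 a 1)

/-- The right `B`-module `_χA = k_χ ⊗_L B = B / {l - χ(l)} B` induced from `χ`
(a right `B`-module is a left module over `Bᵐᵒᵖ`). -/
abbrev RightInduced (χ : L →ₗ[k] k) : Type _ :=
  𝒜.Smash ⧸ (Submodule.span 𝒜.Smashᵐᵒᵖ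
    (Set.range fun l : L => Smash.mk 𝒜 𝒜.one l - χ l • (1 : 𝒜.Smash)))

/-- The class of `a ∈ A ⊂ B` in `_χA`. -/
def toRight (χ : L →ₗ[k] k) (a : A) : 𝒜.RightInduced χ :=
  Submodule.Quotient.mk (Smash.mk 𝒜 a 1)

end DynAlgebra

/-- The subspace `G` of the `H`-module `A` is a unital associative `H`-module algebra under the
bilinear operation `op`, with the unit `e`. -/
structure IsHAlgebraOn (k : Type u) (H : Type v) [Field k] [Ring H] [HopfAlgebra k H]
    {A : Type x} [AddCommGroup A] [Module k A] [Module H A] [IsScalarTower k H A]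
    (op : A →ₗ[k] A →ₗ[k] A) (e : A) (G : Submodule k A) : Prop where
  op_mem : ∀ a ∈ G, ∀ b ∈ G, op a b ∈ G
  unit_mem : e ∈ G
  op_assoc : ∀ a ∈ G, ∀ b ∈ G, ∀ c ∈ G, op (op a b) c = op a (op b c)
  unit_op : ∀ a ∈ G, op e a = a
  op_unit : ∀ a ∈ G, op a e = a
  smul_mem : ∀ h : H, ∀ a ∈ G, h • a ∈ G
  smul_op : ∀ h : H, ∀ a ∈ G, ∀ b ∈ G,
    h • op a b = TensorProduct.lift op (diagAct k H A A h (a ⊗ₜ b))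
  smul_unit : ∀ h : H, h • e = Coalgebra.counit (R := k) h • e

namespace IsHAlgebraOn

variable {k : Type u} {H : Type v} [Field k] [Ring H] [HopfAlgebra k H]
  {A : Type x} [AddCommGroup A] [Module k A] [Module H A] [IsScalarTower k H A]
  {op : A →ₗ[k] A →ₗ[k] A} {e : A} {G : Submodule k A} (hG : IsHAlgebraOn k H op e G)

/-- The `k`-algebra with underlying space `G` and multiplication `op`. -/
def Alg (_hG : IsHAlgebraOn k H op e G) : Type _ := G

/-- The element of the algebra given by an element of `G`. -/
def Alg.mk (a : G) : hG.Alg := a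

instance : AddCommGroup hG.Alg := inferInstanceAs (AddCommGroup G)
instance : Module k hG.Alg := inferInstanceAs (Module k G)

instance : Ring hG.Alg :=
  { (inferInstance : AddCommGroup hG.Alg) with
    mul := fun a b => (⟨op a.1 b.1, hG.op_mem _ a.2 _ b.2⟩ : G)
    one := (⟨e, hG.unit_mem⟩ : G)
    mul_assoc := fun a b c => Subtype.ext (hG.op_assoc _ a.2 _ b.2 _ c.2)
    one_mul := fun a => Subtype.ext (hG.unit_op _ a.2)
    mul_one := fun a => Subtype.ext (hG.op_unit _ a.2)
    left_distrib := fun a b c => Subtype.ext (map_add (op a.1) b.1 c.1)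
    right_distrib := fun a b c => Subtype.ext (LinearMap.congr_fun (map_add op a.1 b.1) c.1)
    zero_mul := fun a => Subtype.ext (LinearMap.congr_fun (map_zero op) a.1)
    mul_zero := fun a => Subtype.ext (map_zero (op a.1)) }

instance : Algebra k hG.Alg :=
  Algebra.ofModule (fun c a b => Subtype.ext (LinearMap.congr_fun (map_smul op c a.1) b.1))
    (fun c a b => Subtype.ext (map_smul (op a.1) c b.1))

end IsHAlgebraOn

end DynBase

end

/-! The endomorphism algebras come from Frobenius reciprocity. The factorizations `B = A L = L A`
identify both induced modules with `A`, and a `B`-endomorphism is determined by the image of `1_A`,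
which can be any vector on which `L` acts through the inducing character. On `A_χ` an element `l`
sends `a` to `ι_χ(l) ▷ a`, so these vectors are the `χ`-generators by definition
(`mem_generators_iff_toLeft`). On the right module `l` sends `a` to `γ̄(ι_χ̃(l)) ▷ a`, and the work
lies in showing that `χ̃` is a character, that it leads to the same vectors, and that it leads to
the same product on them.

The tool is the trace on `H`: `χ̃(l)` is the trace of `h ↦ ι_χ(γ(h) ▷ l)` (`trace_iota`). Cyclicity
of the trace and the commutation rule `mul_iota` between `H` and the image of `ι_χ` give
`trace_mulLeft_iota_slice`, from which invariance and multiplicativity of `χ̃` follow. A further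
contraction gives `ι_χ̃ = γ² ∘ ι_χ ∘ ϑ̄` (`iota_adjointChar`), so the right action of `l` becomes
that of `γ(ι_χ(ϑ̄ ▷ l))`. Since `ϑ̄` is onto (`drinfeldInv_surjective`) and generators can be tested
with `γ ∘ ι_χ` in place of `ι_χ`, the right weight vectors are again the `χ`-generators
(`mem_generators_iff_toRight`).

The two products are the compositions of `⋇` with two projections `B → A`, one along `χ` from `A L`
and one along `χ̃` from `L A`. These projections agree on every element where each `γ(ι_χ(l))` acts
as `χ(l)` (`evalLeft_adjointChar_eq`), and by equivariance `a ⋇ b` is such an element when `a` and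
`b` are generators.

Invertibility of the antipode, used throughout, is proved from finite dimensionality: a trace
formula produces a nonzero integral on `H`, and the integral forces injectivity
(`antipode_injective`). -/

noncomputable section
namespace DynBase

/-! ### Sweedler calculus written out in a basis of `H`. -/

section Sweedler

attribute [local simp] mul_add add_mul smul_add add_smul TensorProduct.tmul_add
  TensorProduct.add_tmul TensorProduct.smul_tmul' Finset.sum_add_distrib Finset.smul_sum

/-- A map of two variables, linear in each of them. -/
structure IsBilin (k : Type*) {M N W : Type*} [Field k] [AddCommGroup M] [Module k M]
    [AddCommGroup N] [Module k N] [AddCommGroup W] [Module k W] (f : M → N → W) : Prop where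
  add_left : ∀ a a' b, f (a + a') b = f a b + f a' b
  smul_left : ∀ (c : k) a b, f (c • a) b = c • f a b
  add_right : ∀ a b b', f a (b + b') = f a b + f a b'
  smul_right : ∀ (c : k) a b, f a (c • b) = c • f a b

/-- A map of three variables, linear in each of them. -/
structure IsTrilin (k : Type*) {M N P W : Type*} [Field k] [AddCommGroup M] [Module k M]
    [AddCommGroup N] [Module k N] [AddCommGroup P] [Module k P] [AddCommGroup W] [Module k W]
    (f : M → N → P → W) : Prop where
  add_left : ∀ a a' b c, f (a + a') b c = f a b c + f a' b c
  smul_left : ∀ (r : k) a b c, f (r • a) b c = r • f a b c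
  add_mid : ∀ a b b' c, f a (b + b') c = f a b c + f a b' c
  smul_mid : ∀ (r : k) a b c, f a (r • b) c = r • f a b c
  add_right : ∀ a b c c', f a b (c + c') = f a b c + f a b c'
  smul_right : ∀ (r : k) a b c, f a b (r • c) = r • f a b c

section Forms

variable {k : Type*} {M N P W : Type*} [Field k] [AddCommGroup M] [Module k M]
    [AddCommGroup N] [Module k N] [AddCommGroup P] [Module k P] [AddCommGroup W] [Module k W]

/-- The bilinear map as a bundled map. -/
def IsBilin.toLin {f : M → N → W} (hf : IsBilin k f) : M →ₗ[k] N →ₗ[k] W :=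
  LinearMap.mk₂ k f hf.add_left hf.smul_left hf.add_right hf.smul_right

/-- The trilinear map as a bundled map. -/
def IsTrilin.toLin {f : M → N → P → W} (hf : IsTrilin k f) : M →ₗ[k] N →ₗ[k] P →ₗ[k] W :=
  LinearMap.mk₂ k
    (fun a b => ({ toFun := f a b, map_add' := hf.add_right a b,
                   map_smul' := fun r c => hf.smul_right r a b c } : P →ₗ[k] W))
    (fun a a' b => LinearMap.ext fun c => hf.add_left a a' b c)
    (fun r a b => LinearMap.ext fun c => hf.smul_left r a b c)
    (fun a b b' => LinearMap.ext fun c => hf.add_mid a b b' c)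
    (fun r a b => LinearMap.ext fun c => hf.smul_mid r a b c)

end Forms

variable (k : Type*) {H : Type*} [Field k] [Ring H] [HopfAlgebra k H] [FiniteDimensional k H]
variable {W : Type*} [AddCommGroup W] [Module k W]

/-- The components of the comultiplication in the chosen basis of `H`:
`Δ(x) = ∑ᵢ eᵢ ⊗ comulCoord i x`. -/
def comulCoord (i : Fin (Module.finrank k H)) : H →ₗ[k] H :=
  (TensorProduct.lid k H).toLinearMap ∘ₗ
    LinearMap.rTensor H ((Module.finBasis k H).coord i) ∘ₗ Coalgebra.comul

/-- The Sweedler sum `f(x⁽¹⁾, x⁽²⁾)`. -/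
def sw (f : H → H → W) (x : H) : W :=
  ∑ i, f (Module.finBasis k H i) (comulCoord k i x)

lemma tmul_expand {M : Type*} [AddCommGroup M] [Module k M] (z : H ⊗[k] M) :
    z = ∑ i, Module.finBasis k H i ⊗ₜ[k]
      TensorProduct.lid k M (LinearMap.rTensor M ((Module.finBasis k H).coord i) z) := by
  induction z with
  | zero => simp
  | add x y hx hy =>
    simp only [map_add, TensorProduct.tmul_add, Finset.sum_add_distrib]
    rw [← hx, ← hy]
  | tmul h m =>
    simp only [LinearMap.rTensor_tmul, TensorProduct.lid_tmul, Module.Basis.coord_apply,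
      TensorProduct.tmul_smul, TensorProduct.smul_tmul', ← TensorProduct.sum_tmul,
      Module.Basis.sum_repr]

lemma apply_eq_sum {F : H → W} (hF : IsLinearMap k F) (x : H) :
    F x = ∑ i, (Module.finBasis k H).coord i x • F (Module.finBasis k H i) := by
  have h := congrArg (hF.mk' F) ((Module.finBasis k H).sum_repr x)
  simp only [map_sum, map_smul, IsLinearMap.mk'_apply] at h
  exact h.symm

lemma comul_eq_sum (x : H) :
    Coalgebra.comul (R := k) x = ∑ i, Module.finBasis k H i ⊗ₜ[k] comulCoord k i x :=
  tmul_expand k _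

lemma lift_comul {f : H → H → W} (hf : IsBilin k f) (x : H) :
    TensorProduct.lift hf.toLin (Coalgebra.comul (R := k) x) = sw k f x := by
  rw [comul_eq_sum]; simp [sw, IsBilin.toLin]

lemma sw_assoc {f : H → H → H → W} (hf : IsTrilin k f) (x : H) :
    sw k (fun a b => sw k (fun c d => f a c d) b) x =
      sw k (fun a b => sw k (fun c d => f c d b) a) x := by
  have h := congrArg (TensorProduct.lift (TensorProduct.uncurry (.id k) H H W ∘ₗ hf.toLin))
    (Coalgebra.coassoc_apply (R := k) x)
  rw [comul_eq_sum] at h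
  simp only [map_sum, LinearMap.rTensor_tmul, LinearMap.lTensor_tmul, comul_eq_sum,
    TensorProduct.tmul_sum, TensorProduct.sum_tmul, TensorProduct.assoc_tmul] at h
  simpa [IsTrilin.toLin, sw] using h.symm

lemma sw_counit_left {f : H → W} (hf : IsLinearMap k f) (x : H) :
    sw k (fun a b => Coalgebra.counit (R := k) a • f b) x = f x := by
  have h := congrArg (TensorProduct.lift (LinearMap.lsmul k W).flip.flip ∘ₗ
    LinearMap.lTensor k (hf.mk' f)) (Coalgebra.rTensor_counit_comul (R := k) x)
  rw [comul_eq_sum] at h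
  simpa [sw] using h

lemma sw_counit_right {f : H → W} (hf : IsLinearMap k f) (x : H) :
    sw k (fun a b => Coalgebra.counit (R := k) b • f a) x = f x := by
  have h := congrArg (TensorProduct.lift (LinearMap.lsmul k W).flip ∘ₗ
    LinearMap.rTensor k (hf.mk' f)) (Coalgebra.lTensor_counit_comul (R := k) x)
  rw [comul_eq_sum] at h
  simpa [sw] using h

lemma sw_antipode_mul {f : H → W} (hf : IsLinearMap k f) (x : H) :
    sw k (fun a b => f (HopfAlgebra.antipode k a * b)) x =
      Coalgebra.counit (R := k) x • f 1 := by
  have h := congrArg (hf.mk' f) (HopfAlgebra.mul_antipode_rTensor_comul_apply (R := k) x)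
  rw [comul_eq_sum, Algebra.algebraMap_eq_smul_one] at h
  simpa [sw] using h

lemma sw_mul_antipode {f : H → W} (hf : IsLinearMap k f) (x : H) :
    sw k (fun a b => f (a * HopfAlgebra.antipode k b)) x =
      Coalgebra.counit (R := k) x • f 1 := by
  have h := congrArg (hf.mk' f) (HopfAlgebra.mul_antipode_lTensor_comul_apply (R := k) x)
  rw [comul_eq_sum, Algebra.algebraMap_eq_smul_one] at h
  simpa [sw] using h

lemma sw_mul {f : H → H → W} (hf : IsBilin k f) (x y : H) :
    sw k f (x * y) = sw k (fun a b => sw k (fun c d => f (a * c) (b * d)) y) x := by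
  rw [← lift_comul k hf, Bialgebra.comul_mul, comul_eq_sum k x, comul_eq_sum k y]
  simp [Finset.sum_mul_sum, sw, IsBilin.toLin]

/-- Uniqueness of inverses in the convolution algebra `Hom(H, H ⊗ H)`: the map `x ↦ γ(x⁽²⁾) ⊗
γ(x⁽¹⁾)` is a left inverse of `Δ`, and `Δ ∘ γ` is a right inverse. -/
lemma comul_antipode (x : H) :
    Coalgebra.comul (R := k) (HopfAlgebra.antipode k x) =
      sw k (fun a b => HopfAlgebra.antipode k b ⊗ₜ[k] HopfAlgebra.antipode k a) x := by
  let S : H →ₗ[k] H := HopfAlgebra.antipode k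
  let G : H →ₗ[k] H ⊗[k] H := TensorProduct.map S S ∘ₗ
    (TensorProduct.comm k H H).toLinearMap ∘ₗ Coalgebra.comul
  have hG : ∀ x, G x = sw k (fun a b => S b ⊗ₜ[k] S a) x := fun x => by
    simp [G, comul_eq_sum, sw]
  have hl : WithConv.toConv G * WithConv.toConv (Coalgebra.comul (R := k) (A := H)) = 1 := by
    refine WithConv.ext (LinearMap.ext fun x => ?_)
    have h1 : (WithConv.toConv G * WithConv.toConv (Coalgebra.comul (R := k) (A := H))).ofConv x =
        sw k (fun a b => sw k (fun p q => sw k (fun r s => (S q * r) ⊗ₜ[k] (S p * s)) b) a) x := by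
      simp [LinearMap.convMul_def, comul_eq_sum k x, hG, sw, comul_eq_sum k (comulCoord k _ x),
        Finset.sum_mul_sum]
    rw [h1, ← sw_assoc k (f := fun p q b => sw k (fun r s => (S q * r) ⊗ₜ[k] (S p * s)) b)
      (by constructor <;> intros <;> simp [sw])]
    trans sw k (fun a b => (1 : H) ⊗ₜ[k] (S a * b)) x
    · refine congrArg (fun F => sw k F x) (funext₂ fun a b => ?_)
      rw [sw_assoc k (f := fun q r s => (S q * r) ⊗ₜ[k] (S a * s))
        (by constructor <;> intros <;> simp)]
      trans sw k (fun c d => Coalgebra.counit (R := k) c • ((1 : H) ⊗ₜ[k] (S a * d))) b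
      · refine congrArg (fun F => sw k F b) (funext₂ fun c d => ?_)
        exact sw_antipode_mul k (f := fun z => z ⊗ₜ[k] (S a * d))
          (by constructor <;> intros <;> simp) c
      · exact sw_counit_left k (f := fun d => (1 : H) ⊗ₜ[k] (S a * d))
          (by constructor <;> intros <;> simp) b
    · rw [sw_antipode_mul k (f := fun z => (1 : H) ⊗ₜ[k] z)
        (by constructor <;> intros <;> simp)]
      simp [LinearMap.convOne_def, Algebra.algebraMap_eq_smul_one, Algebra.TensorProduct.one_def]
  have h := left_inv_eq_right_inv hl (LinearMap.comul_right_inv (R := k) (C := H))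
  have := LinearMap.congr_fun (congrArg WithConv.ofConv h) x
  rw [← hG, ← LinearMap.comp_apply]
  exact this.symm

lemma sw_antipode {f : H → H → W} (hf : IsBilin k f) (x : H) :
    sw k f (HopfAlgebra.antipode k x) =
      sw k (fun a b => f (HopfAlgebra.antipode k b) (HopfAlgebra.antipode k a)) x := by
  rw [← lift_comul k hf, comul_antipode]
  simp [sw, IsBilin.toLin]

lemma sw_map {V : Type*} [AddCommGroup V] [Module k V] {F : V → W} (hF : IsLinearMap k F)
    (f : H → H → V) (x : H) : F (sw k f x) = sw k (fun a b => F (f a b)) x := by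
  change hF.mk' F _ = _
  simp [sw]

omit [Module k W] in
lemma sw_comm (F : H → H → H → H → W) (x y : H) :
    sw k (fun a b => sw k (fun c d => F a b c d) y) x =
      sw k (fun c d => sw k (fun a b => F a b c d) x) y :=
  Finset.sum_comm

omit [Module k W] in
lemma sw_sum {ι : Type*} [Fintype ι] (F : ι → H → H → W) (x : H) :
    ∑ i, sw k (F i) x = sw k (fun a b => ∑ i, F i a b) x :=
  Finset.sum_comm

/-- `sliceRight f x = x⁽¹⁾ f(x⁽²⁾)`. -/
def sliceRight (f : H →ₗ[k] k) : H →ₗ[k] H :=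
  (TensorProduct.rid k H).toLinearMap ∘ₗ LinearMap.lTensor H f ∘ₗ Coalgebra.comul

lemma sliceRight_apply (f : H →ₗ[k] k) (x : H) :
    sliceRight k f x = sw k (fun a b => f b • a) x := by
  simp [sliceRight, sw, comul_eq_sum k x]

lemma trace_eq_sum (X : H →ₗ[k] H) :
    LinearMap.trace k H X =
      ∑ i, (Module.finBasis k H).coord i (X (Module.finBasis k H i)) := by
  rw [LinearMap.trace_eq_matrix_trace k (Module.finBasis k H)]
  simp [Matrix.trace, LinearMap.toMatrix_apply]

omit [FiniteDimensional k H] in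
lemma trace_comp_comm (X Y : H →ₗ[k] H) :
    LinearMap.trace k H (X ∘ₗ Y) = LinearMap.trace k H (Y ∘ₗ X) :=
  LinearMap.trace_mul_comm k X Y

end Sweedler

/-! ### Integrals by a trace formula, and bijectivity of the antipode. -/

section Antipode

open HopfAlgebra

attribute [local simp] mul_add add_mul smul_add add_smul TensorProduct.tmul_add
  TensorProduct.add_tmul TensorProduct.smul_tmul' Finset.sum_add_distrib Finset.smul_sum

variable (k : Type*) {H : Type*} [Field k] [Ring H] [HopfAlgebra k H] [FiniteDimensional k H]
variable {W : Type*} [AddCommGroup W] [Module k W]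

/-- In the expansion of `Δ(y γ(h⁽¹⁾))` the first leg ends in an antipode that cancels against the
remaining leg of `h`. When `f` is an integral the right side reduces to `f(y γ(h⁽¹⁾)) h⁽²⁾`, which
is the form needed for injectivity of the antipode. -/
lemma sw_mul_antipode_eq (f : H →ₗ[k] k) (y h : H) :
    sw k (fun a b => f (b * antipode k h) • a) y =
      sw k (fun p q => sw k (fun a b => f b • (a * q)) (y * antipode k p)) h := by
  symm
  have h1 : ∀ p q, sw k (fun a b => f b • (a * q)) (y * antipode k p) =
      sw k (fun a b => sw k (fun c d => f (b * antipode k c) • (a * (antipode k d * q))) p) y := by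
    intro p q
    rw [sw_mul k (f := fun a b => f b • (a * q))
      (by constructor <;> intros <;> simp [smul_smul, mul_comm])]
    refine congrArg (fun F => sw k F y) (funext₂ fun a b => ?_)
    rw [sw_antipode k (f := fun c d => f (b * d) • (a * c * q))
      (by constructor <;> intros <;> simp [smul_smul, mul_comm])]
    simp only [mul_assoc]
  simp only [h1]
  rw [sw_comm k (fun p q a b =>
    sw k (fun c d => f (b * antipode k c) • (a * (antipode k d * q))) p)]
  refine congrArg (fun F => sw k F y) (funext₂ fun a b => ?_)
  rw [← sw_assoc k (f := fun c d q => f (b * antipode k c) • (a * (antipode k d * q)))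
    (by constructor <;> intros <;> simp [smul_smul, mul_comm])]
  trans sw k (fun c d => Coalgebra.counit (R := k) d • (f (b * antipode k c) • a)) h
  · refine congrArg (fun F => sw k F h) (funext₂ fun c d => ?_)
    rw [sw_antipode_mul k (f := fun z => f (b * antipode k c) • (a * z))
      (by constructor <;> intros <;> simp [smul_smul, mul_comm]), mul_one]
  · exact sw_counit_right k (f := fun c => f (b * antipode k c) • a)
      (by constructor <;> intros <;> simp [smul_smul]) h

/-- The trace formula for an integral on `H`. -/
def traceIntegral (f : H →ₗ[k] k) : H →ₗ[k] k where
  toFun x := LinearMap.trace k H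
    (sliceRight k f ∘ₗ LinearMap.mulLeft k x ∘ₗ antipode k ∘ₗ antipode k)
  map_add' x y := by
    rw [← map_add]; congr 1; ext z; simp
  map_smul' c x := by
    rw [RingHom.id_apply, ← map_smul]; congr 1; ext z; simp

lemma traceIntegral_apply (f : H →ₗ[k] k) (x : H) :
    traceIntegral k f x = ∑ i, (Module.finBasis k H).coord i
      (sliceRight k f (x * antipode k (antipode k (Module.finBasis k H i)))) :=
  trace_eq_sum k _

/-- By coassociativity the left side is `u⁽¹⁾ γ(u⁽²⁾) φ(u⁽³⁾) f(u⁽⁴⁾)`. -/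
lemma sliceRight_mul_antipode (f φ : H →ₗ[k] k) (u : H) :
    sw k (fun r c => sw k (fun p q => φ q • (r * antipode k p)) (sliceRight k f c)) u =
      φ (sliceRight k f u) • (1 : H) := by
  have h1 : ∀ r c, sw k (fun p q => φ q • (r * antipode k p)) (sliceRight k f c) =
      sw k (fun p b => φ (sliceRight k f b) • (r * antipode k p)) c := by
    intro r c
    rw [sliceRight_apply, sw_map k (F := sw k (fun p q => φ q • (r * antipode k p)))
      (by constructor <;> intros <;> simp [sw, smul_smul])]
    trans sw k (fun d e => sw k (fun p q => f e • φ q • (r * antipode k p)) d) c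
    · refine congrArg (fun F => sw k F c) (funext₂ fun d e => ?_)
      simp [sw, smul_smul]
    rw [← sw_assoc k (f := fun p q e => f e • φ q • (r * antipode k p))
      (by constructor <;> intros <;> simp [smul_smul, mul_comm, mul_left_comm])]
    refine congrArg (fun F => sw k F c) (funext₂ fun p b => ?_)
    rw [sliceRight_apply]
    simp [sw, smul_smul, Finset.sum_smul]
  simp only [h1]
  rw [sw_assoc k (f := fun r p b => φ (sliceRight k f b) • (r * antipode k p))
    (by constructor <;> intros <;> simp [smul_smul, mul_comm])]
  trans sw k (fun a b => Coalgebra.counit (R := k) a • (φ (sliceRight k f b) • (1 : H))) u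
  · refine congrArg (fun F => sw k F u) (funext₂ fun a b => ?_)
    exact sw_mul_antipode k (f := fun z => φ (sliceRight k f b) • z)
      (by constructor <;> intros <;> simp [smul_smul, mul_comm]) a
  · exact sw_counit_left k (f := fun b => φ (sliceRight k f b) • (1 : H))
      (by constructor <;> intros <;> simp [smul_smul]) u

/-- The integral property of the trace formula. The factor `γ²(eᵢ)` allows `sw_mul_antipode_eq` with
`h = γ(eᵢ)`, which moves the free leg of `z` into an antipode of a leg of `eᵢ`; cyclicity of the
trace then brings the legs into the order in which they cancel. -/
lemma sliceRight_traceIntegral (f : H →ₗ[k] k) (z : H) :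
    sliceRight k (traceIntegral k f) z = traceIntegral k f z • (1 : H) := by
  let e := Module.finBasis k H
  let Wz : H →ₗ[k] H := LinearMap.mulLeft k z ∘ₗ antipode k ∘ₗ antipode k
  trans ∑ i, sw k (fun a c => (e.coord i ∘ₗ sliceRight k f) (c * antipode k (antipode k (e i)))
      • a) z
  · simp only [sliceRight_apply k (traceIntegral k f), traceIntegral_apply, sw, Finset.sum_smul]
    rw [Finset.sum_comm]; rfl
  trans ∑ i, sw k (fun p q => sw k (fun a b => (e.coord i ∘ₗ sliceRight k f) b • (a * antipode k p))
      (Wz q)) (e i)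
  · refine Finset.sum_congr rfl fun i _ => ?_
    rw [sw_mul_antipode_eq, sw_antipode k (f := fun p q =>
      sw k (fun a b => (e.coord i ∘ₗ sliceRight k f) b • (a * q)) (z * antipode k p))
      (by constructor <;> intros <;> simp [sw, smul_smul, mul_comm])]
    rfl
  -- Both legs of the coproducts are expanded, so that the coefficients are traces and `comulCoord k
  -- p` can be moved from the innermost to the outermost place.
  trans ∑ p, ∑ r, LinearMap.trace k H (sliceRight k f ∘ₗ comulCoord k r ∘ₗ Wz ∘ₗ comulCoord k p) •
      (e r * antipode k (e p))
  · simp only [trace_eq_sum, sw, Finset.sum_smul]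
    rw [Finset.sum_comm]
    refine Finset.sum_congr rfl fun p _ => ?_
    rw [Finset.sum_comm]
    rfl
  trans ∑ i, sw k (fun r c => sw k (fun p q => e.coord i q • (r * antipode k p))
      (sliceRight k f c)) (Wz (e i))
  · have h : ∀ p r, LinearMap.trace k H
        (sliceRight k f ∘ₗ comulCoord k r ∘ₗ Wz ∘ₗ comulCoord k p) =
        LinearMap.trace k H (comulCoord k p ∘ₗ sliceRight k f ∘ₗ comulCoord k r ∘ₗ Wz) := by
      intro p r
      rw [trace_comp_comm k (comulCoord k p)]
      rfl
    simp only [h, trace_eq_sum, sw, Finset.sum_smul]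
    rw [Finset.sum_comm]
    conv_rhs => rw [Finset.sum_comm]
    refine Finset.sum_congr rfl fun r _ => ?_
    rw [Finset.sum_comm]
    rfl
  simp only [sliceRight_mul_antipode]
  rw [traceIntegral_apply, Finset.sum_smul]
  rfl

lemma sum_comm₄ {ι κ α β : Type*} [Fintype ι] [Fintype κ] [Fintype α] [Fintype β]
    (F : ι → κ → α → β → k) :
    ∑ i, ∑ j, ∑ a, ∑ b, F i j a b = ∑ a, ∑ b, ∑ i, ∑ j, F i j a b := by
  calc _ = ∑ i, ∑ a, ∑ b, ∑ j, F i j a b := by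
        refine Finset.sum_congr rfl fun i _ => ?_
        rw [Finset.sum_comm]
        exact Finset.sum_congr rfl fun a _ => Finset.sum_comm
    _ = ∑ a, ∑ b, ∑ i, ∑ j, F i j a b := by
        rw [Finset.sum_comm]
        exact Finset.sum_congr rfl fun a _ => Finset.sum_comm

/-- Every functional is recovered from trace integrals, so they cannot all vanish. The left side
becomes `∑ₚ eᵖ(x γ(d) γ²(c)) f(b)` with `eₚ` split as `c ⊗ d ⊗ b`, and `γ(d) γ²(c) = γ(γ(c) d)`
collapses to the counit. -/
lemma sum_traceIntegral (f : H →ₗ[k] k) (x : H) :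
    ∑ j, traceIntegral k ((Module.finBasis k H).coord j ∘ₗ sliceRight k f)
      (x * antipode k (Module.finBasis k H j)) = f x := by
  let e := Module.finBasis k H
  let Q : Fin (Module.finrank k H) → Fin (Module.finrank k H) → H → k := fun i j w =>
    sw k (fun a b => sw k (fun c d => e.coord i c * e.coord j d * f b) a) w
  have hQ : ∀ i j w, e.coord i (sliceRight k (e.coord j ∘ₗ sliceRight k f) w) = Q i j w := by
    intro i j w
    simp only [Q]
    rw [← sw_assoc k (f := fun c d b => e.coord i c * e.coord j d * f b)
      (by constructor <;> intros <;> simp [mul_comm, mul_left_comm, mul_assoc]), sliceRight_apply]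
    simp [sw, sliceRight_apply, mul_comm, mul_left_comm, Finset.mul_sum]
  have hlin : ∀ i j w, Q i j w = ∑ p, e.coord p w * Q i j (e p) := by
    intro i j w
    have h := apply_eq_sum k
      (e.coord i ∘ₗ sliceRight k (e.coord j ∘ₗ sliceRight k f)).isLinear w
    simpa only [LinearMap.comp_apply, hQ, smul_eq_mul] using h
  have hB : ∀ p c d, e.coord p (x * (antipode k d * antipode k (antipode k c))) =
      ∑ j, ∑ i, e.coord p (x * (antipode k (e j) * antipode k (antipode k (e i)))) *
        (e.coord i c * e.coord j d) := by
    intro p c d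
    rw [apply_eq_sum k (F := fun d => e.coord p (x * (antipode k d * antipode k (antipode k c))))
      (by constructor <;> intros <;> simp) d]
    refine Finset.sum_congr rfl fun j _ => ?_
    rw [apply_eq_sum k (F := fun c => e.coord p
      (x * (antipode k (e j) * antipode k (antipode k c))))
      (by constructor <;> intros <;> simp) c, Finset.smul_sum]
    refine Finset.sum_congr rfl fun i _ => ?_
    simp only [smul_eq_mul, e]
    ring
  trans ∑ p, sw k (fun a b => sw k (fun c d =>
      e.coord p (x * (antipode k d * antipode k (antipode k c)))) a * f b) (e p)
  · simp only [traceIntegral_apply]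
    change ∑ j, ∑ i, e.coord i (sliceRight k (e.coord j ∘ₗ sliceRight k f) _) = _
    simp only [hQ]
    trans ∑ p, ∑ j, ∑ i,
      e.coord p (x * (antipode k (e j) * antipode k (antipode k (e i)))) * Q i j (e p)
    · symm
      rw [Finset.sum_comm]
      refine Finset.sum_congr rfl fun j _ => ?_
      rw [Finset.sum_comm]
      refine Finset.sum_congr rfl fun i _ => ?_
      rw [hlin, mul_assoc]
    · refine Finset.sum_congr rfl fun p _ => ?_
      trans sw k (fun a b => sw k (fun c d => ∑ j, ∑ i,
        e.coord p (x * (antipode k (e j) * antipode k (antipode k (e i)))) *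
          (e.coord i c * e.coord j d)) a * f b) (e p)
      · simp only [Q, sw, Finset.sum_mul, Finset.mul_sum]
        rw [sum_comm₄]
        simp only [mul_assoc]
      · simp only [← hB]
  · trans ∑ p, sw k (fun a b => Coalgebra.counit (R := k) a • (e.coord p x * f b)) (e p)
    · refine Finset.sum_congr rfl fun p _ => congrArg (fun F => sw k F (e p))
        (funext₂ fun a b => ?_)
      have := sw_antipode_mul k (f := fun z => e.coord p (x * antipode k z))
          (by constructor <;> intros <;> simp) a
      simp only [HopfAlgebra.antipode_mul_antidistrib, antipode_one, mul_one] at this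
      rw [this, smul_eq_mul, smul_eq_mul, mul_assoc]
    · have : ∀ p, sw k (fun a b => Coalgebra.counit (R := k) a • (e.coord p x * f b)) (e p) =
          e.coord p x * f (e p) := fun p =>
        sw_counit_left k (f := fun b => e.coord p x * f b)
          (by constructor <;> intros <;> simp [mul_left_comm]) (e p)
      simp only [this]
      exact (apply_eq_sum k f.isLinear x).symm

/-- A finite dimensional Hopf algebra has a nonzero integral in its dual. -/
lemma exists_integral : ∃ p : H →ₗ[k] k, p ≠ 0 ∧ ∀ x, sliceRight k p x = p x • (1 : H) := by
  by_contra hcon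
  push Not at hcon
  have h0 : ∀ f : H →ₗ[k] k, traceIntegral k f = 0 := by
    intro f
    by_contra hf
    obtain ⟨x, hx⟩ := hcon _ hf
    exact hx (sliceRight_traceIntegral k f x)
  -- The counit is recovered from trace integrals; if all of these vanished, `ε(1)` would be zero.
  have h1 : (Coalgebra.counit : H →ₗ[k] k) 1 = 0 := by
    rw [← sum_traceIntegral k Coalgebra.counit (1 : H)]
    simp [h0]
  simp at h1

/-- If `γ(h) = 0` and `p` is a nonzero integral, then `p(y γ(h⁽¹⁾)) h⁽²⁾ = 0` for all `y`. Letting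
`y` absorb a further leg gives `0 = p(x γ²(h⁽²⁾) γ(h⁽¹⁾)) h⁽³⁾ = p(x) h`, and `x` is chosen with
`p(x) ≠ 0`. -/
lemma antipode_injective : Function.Injective (antipode k : H →ₗ[k] H) := by
  rw [← LinearMap.ker_eq_bot, LinearMap.ker_eq_bot']
  intro h hh
  obtain ⟨p, hp0, hp⟩ := exists_integral k (H := H)
  have hv : ∀ y, sw k (fun a b : H => p (y * antipode k a) • b) h = 0 := by
    intro y
    have h1 := sw_mul_antipode_eq k p y h
    have h2 : ∀ a b, sw k (fun c d => p d • (c * b)) (y * antipode k a) =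
        p (y * antipode k a) • b := by
      intro a b
      have h3 := congrArg (· * b) (hp (y * antipode k a))
      rw [sliceRight_apply] at h3
      simpa [sw, Finset.sum_mul] using h3
    simp only [h2] at h1
    rw [← h1]
    simp [sw, hh]
  obtain ⟨x, hx⟩ : ∃ x, p x ≠ 0 := by
    by_contra hcon
    push Not at hcon
    exact hp0 (LinearMap.ext hcon)
  -- The vanishing statement is used at `y = x γ²(eᵢ)`; its `eᵢ`-component under `Δ` is taken, and
  -- the results are summed over `i`.
  have h4 : sw k (fun a b => sw k (fun c d =>
      p (x * (antipode k (antipode k c) * antipode k a)) • d) b) h = 0 := by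
    have h5 : ∀ i, comulCoord k i (sw k (fun a b =>
        p (x * antipode k (antipode k (Module.finBasis k H i)) * antipode k a) • b) h) = 0 :=
      fun i => by rw [hv, map_zero]
    simp only [sw, map_sum, map_smul] at h5
    simp only [sw]
    rw [Finset.sum_comm]
    simp only [← mul_assoc]
    exact Finset.sum_eq_zero fun i _ => h5 i
  rw [sw_assoc k (f := fun a c d => p (x * (antipode k (antipode k c) * antipode k a)) • d)
    (by constructor <;> intros <;> simp [smul_smul, mul_comm])] at h4
  have h6 : ∀ a b : H, sw k (fun c d => p (x * (antipode k (antipode k d) * antipode k c)) • b) a =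
      Coalgebra.counit (R := k) a • (p x • b) := by
    intro a b
    have := sw_mul_antipode k (f := fun z : H => p (x * antipode k z) • b)
      (by constructor <;> intros <;> simp [smul_smul]) a
    simpa only [HopfAlgebra.antipode_mul_antidistrib, antipode_one, mul_one] using this
  simp only [h6] at h4
  rw [sw_counit_left k (f := fun b : H => p x • b)
    (by constructor <;> intros <;> simp [smul_smul, mul_comm])] at h4
  exact (smul_eq_zero.mp h4).resolve_left hx

lemma antipode_bijective : Function.Bijective (antipode k : H →ₗ[k] H) :=
  ⟨antipode_injective k, LinearMap.injective_iff_surjective.mp (antipode_injective k)⟩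

lemma antipode_antipodeInv (x : H) : antipode k (antipodeInv k H x) = x := by
  have hu : IsUnit (M := Module.End k H) (antipode k) :=
    (Module.End.isUnit_iff _).mpr (antipode_bijective k)
  exact LinearMap.congr_fun (Ring.mul_inverse_cancel _ hu) x

lemma antipodeInv_antipode (x : H) : antipodeInv k H (antipode k x) = x :=
  antipode_injective k (antipode_antipodeInv k _)

lemma antipodeInv_mul (x y : H) :
    antipodeInv k H (x * y) = antipodeInv k H y * antipodeInv k H x :=
  antipode_injective k (by
    rw [HopfAlgebra.antipode_mul_antidistrib]; simp only [antipode_antipodeInv])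

lemma antipodeInv_one : antipodeInv k H 1 = 1 :=
  antipode_injective k (by rw [antipode_antipodeInv, antipode_one])

lemma sw_mul_antipodeInv {f : H → W} (hf : IsLinearMap k f) (x : H) :
    sw k (fun a b => f (b * antipodeInv k H a)) x = Coalgebra.counit (R := k) x • f 1 := by
  have h := sw_mul_antipode k (f := fun z => f (antipodeInv k H z))
    (by constructor <;> intros <;> simp [hf.map_add, hf.map_smul]) x
  simpa only [antipodeInv_mul, antipodeInv_antipode, antipodeInv_one] using h

lemma sw_antipodeInv_mul {f : H → W} (hf : IsLinearMap k f) (x : H) :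
    sw k (fun a b => f (antipodeInv k H b * a)) x = Coalgebra.counit (R := k) x • f 1 := by
  have h := sw_antipode_mul k (f := fun z => f (antipodeInv k H z))
    (by constructor <;> intros <;> simp [hf.map_add, hf.map_smul]) x
  simpa only [antipodeInv_mul, antipodeInv_antipode, antipodeInv_one] using h

end Antipode


/-! ### Sweedler sums for the coaction, and the homomorphism `ι_χ`. -/

namespace Base

open HopfAlgebra

attribute [local simp] mul_add add_mul smul_add add_smul TensorProduct.tmul_add
  TensorProduct.add_tmul TensorProduct.smul_tmul' Finset.sum_add_distrib Finset.smul_sum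

variable {k H L : Type*} [Field k] [Ring H] [HopfAlgebra k H] [FiniteDimensional k H]
  [Ring L] [Algebra k L] [Module H L] [IsScalarTower k H L] (D : Base k H L)
  {W : Type*} [AddCommGroup W] [Module k W]

/-- The Sweedler sum `f(l⁽¹⁾, l^[∞])` of the coaction. -/
def co (f : H → L → W) (l : L) : W :=
  ∑ i, f (Module.finBasis k H i) (D.dualAct ((Module.finBasis k H).coord i) l)

lemma coact_eq_sum (l : L) : D.coact l =
    ∑ i, Module.finBasis k H i ⊗ₜ[k] D.dualAct ((Module.finBasis k H).coord i) l :=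
  tmul_expand k _

lemma lift_coact {f : H → L → W} (hf : IsBilin k f) (l : L) :
    TensorProduct.lift hf.toLin (D.coact l) = D.co f l := by
  rw [coact_eq_sum]; simp [co, IsBilin.toLin]

lemma co_assoc {f : H → H → L → W} (hf : IsTrilin k f) (l : L) :
    D.co (fun a m => D.co (fun b n => f a b n) m) l =
      D.co (fun a m => sw k (fun b c => f b c m) a) l := by
  have h := congrArg (TensorProduct.lift (TensorProduct.uncurry (.id k) H L W ∘ₗ hf.toLin))
    (D.coassoc l)
  rw [coact_eq_sum] at h
  simp only [map_sum, LinearMap.rTensor_tmul, LinearMap.lTensor_tmul, AlgHom.toLinearMap_apply,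
    coact_eq_sum, comul_eq_sum, TensorProduct.tmul_sum, TensorProduct.sum_tmul,
    TensorProduct.assoc_tmul] at h
  simpa [IsTrilin.toLin, sw, co] using h.symm

lemma co_counit {f : L → W} (hf : IsLinearMap k f) (l : L) :
    D.co (fun a m => Coalgebra.counit (R := k) a • f m) l = f l := by
  have h := congrArg (hf.mk' f) (D.counit_coact l)
  rw [coact_eq_sum] at h
  simpa [co] using h

lemma co_mul {f : H → L → W} (hf : IsBilin k f) (l m : L) :
    D.co f (l * m) = D.co (fun a p => D.co (fun b q => f (a * b) (p * q)) m) l := by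
  rw [← lift_coact D hf, map_mul, coact_eq_sum D l, coact_eq_sum D m]
  simp [Finset.sum_mul_sum, co, IsBilin.toLin]

lemma co_one {f : H → L → W} (hf : IsBilin k f) : D.co f 1 = f 1 1 := by
  rw [← lift_coact D hf, map_one, Algebra.TensorProduct.one_def]
  simp [IsBilin.toLin]

lemma co_map {V : Type*} [AddCommGroup V] [Module k V] {F : V → W} (hF : IsLinearMap k F)
    (f : H → L → V) (l : L) : F (D.co f l) = D.co (fun a b => F (f a b)) l := by
  change hF.mk' F _ = _
  simp [co]

lemma co_smul_act {f : H → L → W} (hf : IsBilin k f) (h : H) (l : L) :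
    D.co f (h • l) = sw k (fun p q => sw k (fun b c =>
      D.co (fun a m => f (p * a * antipode k c) (b • m)) l) q) h := by
  rw [← lift_coact D hf, D.yetterDrinfeld]
  simp only [ydAct, LinearMap.comp_apply, comul_eq_sum, map_sum, LinearMap.lTensor_tmul,
    TensorProduct.tmul_sum, coact_eq_sum]
  simp only [sw, co, LinearMap.sum_apply]
  simp only [map_sum, TensorProduct.lift.tmul, LinearMap.compl₁₂_apply]
  simp only [LinearMap.mul_apply', Module.End.mul_apply, LinearMap.comp_apply,
    LinearMap.coe_rTensorHom, AlgHom.toLinearMap_apply, LinearEquiv.coe_coe,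
    TensorProduct.comm_tmul, TensorProduct.map_tmul, TensorProduct.homTensorHomMap_apply,
    LinearMap.flip_apply, LinearMap.rTensor_tmul, Algebra.lsmul_coe, TensorProduct.lift.tmul]
  rw [Finset.sum_comm]
  refine Finset.sum_congr rfl fun p _ => ?_
  rw [Finset.sum_comm]
  simp [IsBilin.toLin, mul_assoc]

include D in
lemma smul_mul_eq (h : H) (l m : L) :
    h • (l * m) = sw k (fun a b => (a • l) * (b • m)) h := by
  rw [Base.smul_mul D, DynAlgebra.diagAct_eq, comul_eq_sum]
  simp [sw]

lemma iota_apply (χ : L →ₗ[k] k) (l : L) : D.iota χ l = D.co (fun a m => χ m • a) l := by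
  simp [iota, co, coact_eq_sum D l]

variable {D} {χ : L →ₗ[k] k}

lemma counit_iota (l : L) : Coalgebra.counit (R := k) (D.iota χ l) = χ l := by
  rw [iota_apply, D.co_map (F := Coalgebra.counit (R := k) (A := H))
    (by constructor <;> intros <;> simp)]
  have := D.co_counit (f := χ) (by constructor <;> intros <;> simp) l
  simpa [mul_comm] using this

/-- `Δ(ι_χ(l)) = l⁽¹⁾ ⊗ ι_χ(l^[∞])`. -/
lemma sw_iota {f : H → H → W} (hf : IsBilin k f) (l : L) :
    sw k f (D.iota χ l) = D.co (fun a m => f a (D.iota χ m)) l := by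
  rw [iota_apply, D.co_map (F := sw k f)
    (by constructor <;> intros <;> simp [sw, hf.add_right, hf.smul_right])]
  trans D.co (fun a m => sw k (fun b c => χ m • f b c) a) l
  · refine congrArg (fun F => D.co F l) (funext₂ fun a b => ?_)
    simp [sw, hf.smul_right]
  rw [← D.co_assoc (f := fun b c m => χ m • f b c)
    (by constructor <;> intros <;> simp [hf.add_left, hf.add_right, hf.smul_left, hf.smul_right,
      smul_smul, mul_comm])]
  refine congrArg (fun F => D.co F l) (funext₂ fun a m => ?_)
  rw [iota_apply, D.co_map (F := fun z => f a z)
    (by constructor <;> intros <;> simp [hf.add_right, hf.smul_right])]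
  simp [co, hf.smul_right]

variable (hχ : D.IsInvariantCharacter χ)
include hχ

lemma iota_mul (l m : L) : D.iota χ (l * m) = D.iota χ l * D.iota χ m := by
  rw [iota_apply, D.co_mul (f := fun a m => χ m • a)
    (by constructor <;> intros <;> simp [smul_smul, mul_comm]), iota_apply, iota_apply]
  simp [co, hχ.map_mul, Finset.sum_mul_sum, smul_smul, mul_comm]

lemma iota_one : D.iota χ 1 = 1 := by
  rw [iota_apply, D.co_one (f := fun a m => χ m • a)
    (by constructor <;> intros <;> simp [smul_smul, mul_comm]), hχ.map_one, one_smul]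

/-- `ι_χ(h ▷ l) = h⁽¹⁾ ι_χ(l) γ(h⁽²⁾)`. -/
lemma iota_smul (h : H) (l : L) :
    D.iota χ (h • l) = sw k (fun a b => a * D.iota χ l * antipode k b) h := by
  rw [iota_apply, D.co_smul_act (f := fun a m => χ m • a)
    (by constructor <;> intros <;> simp [smul_smul, mul_comm])]
  refine congrArg (fun F => sw k F h) (funext₂ fun p q => ?_)
  have := sw_counit_left k (f := fun c => p * D.iota χ l * antipode k c)
    (by constructor <;> intros <;> simp) q
  rw [← this]
  refine congrArg (fun F => sw k F q) (funext₂ fun b c => ?_)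
  simp [iota_apply, co, hχ.invariant, Finset.mul_sum, Finset.sum_mul, smul_smul]

/-- `h ι_χ(l) = ι_χ(h⁽¹⁾ ▷ l) h⁽²⁾`. -/
lemma mul_iota (h : H) (l : L) :
    h * D.iota χ l = sw k (fun a b => D.iota χ (a • l) * b) h := by
  symm
  trans sw k (fun a b => sw k (fun c d => c * D.iota χ l * (antipode k d * b)) a) h
  · refine congrArg (fun F => sw k F h) (funext₂ fun a b => ?_)
    rw [iota_smul hχ, sw_map k (F := fun z => z * b) (by constructor <;> intros <;> simp)]
    simp only [mul_assoc]
  rw [← sw_assoc k (f := fun c d b => c * D.iota χ l * (antipode k d * b))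
    (by constructor <;> intros <;> simp)]
  trans sw k (fun a b => Coalgebra.counit (R := k) b • (a * D.iota χ l)) h
  · refine congrArg (fun F => sw k F h) (funext₂ fun a b => ?_)
    rw [sw_antipode_mul k (f := fun z => a * D.iota χ l * z)
      (by constructor <;> intros <;> simp), mul_one]
  · exact sw_counit_right k (f := fun a => a * D.iota χ l)
      (by constructor <;> intros <;> simp) h

/-- `ι_χ(l) h = h⁽²⁾ ι_χ(γ̄(h⁽¹⁾) ▷ l)`. -/
lemma iota_mul_eq (h : H) (l : L) :
    D.iota χ l * h = sw k (fun a b => b * D.iota χ (antipodeInv k H a • l)) h := by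
  symm
  simp only [mul_iota hχ, ← mul_smul]
  rw [sw_assoc k (f := fun a c d => D.iota χ ((c * antipodeInv k H a) • l) * d)
    (by constructor <;> intros <;> simp [smul_assoc])]
  trans sw k (fun a b => Coalgebra.counit (R := k) a • (D.iota χ l * b)) h
  · refine congrArg (fun F => sw k F h) (funext₂ fun a b => ?_)
    rw [sw_mul_antipodeInv k (f := fun z => D.iota χ (z • l) * b)
      (by constructor <;> intros <;> simp [smul_assoc]), one_smul]
  · exact sw_counit_left k (f := fun b => D.iota χ l * b)
      (by constructor <;> intros <;> simp) h

omit hχ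

variable (k H) in
/-- `h ↦ γ(h) ▷ l`. -/
def antipodeAct (l : L) : H →ₗ[k] L := (act k H L).toLinearMap.flip l ∘ₗ antipode k

omit [FiniteDimensional k H] in
@[simp]
lemma antipodeAct_apply (l : L) (h : H) : antipodeAct k H l h = antipode k h • l := rfl

lemma drinfeldInv_apply (l : L) : D.drinfeldInv l =
    ∑ i, D.dualAct ((Module.finBasis k H).coord i) (antipode k (Module.finBasis k H i) • l) := by
  simp [drinfeldInv]

end Base

/-! ### The adjoint character as a trace, and its invariance. -/

namespace Base

open HopfAlgebra

attribute [local simp] mul_add add_mul smul_add add_smul TensorProduct.tmul_add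
  TensorProduct.add_tmul TensorProduct.smul_tmul' Finset.sum_add_distrib Finset.smul_sum

variable {k H L : Type*} [Field k] [Ring H] [HopfAlgebra k H] [FiniteDimensional k H]
  [Ring L] [Algebra k L] [Module H L] [IsScalarTower k H L] {D : Base k H L}
  {χ : L →ₗ[k] k}

lemma counit_sliceRight : sliceRight k (Coalgebra.counit (R := k) (A := H)) = .id := by
  ext x
  rw [sliceRight_apply]
  exact sw_counit_right k (f := id) (by constructor <;> intros <;> simp) x

/-- After a cyclic shift the slice acts on `ι_χ(m)` with `m = γ(hᵢ) ▷ l`. As `Δ(ι_χ(m)) = m⁽¹⁾ ⊗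
ι_χ(m^[∞])`, the `i`-th diagonal entry is `f(ι_χ(ηⁱ ▷ m))`, and these entries add up to the action
of `ϑ̄`. -/
lemma trace_iota_slice (f : H →ₗ[k] k) (l : L) :
    LinearMap.trace k H (D.iota χ ∘ₗ antipodeAct k H l ∘ₗ sliceRight k f) =
      f (D.iota χ (D.drinfeldInv l)) := by
  rw [← LinearMap.comp_assoc, trace_comp_comm, trace_eq_sum, drinfeldInv_apply, map_sum, map_sum]
  refine Finset.sum_congr rfl fun i _ => ?_
  simp only [LinearMap.comp_apply, antipodeAct_apply, sliceRight_apply]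
  rw [sw_iota (f := fun a b => f b • a)
    (by constructor <;> intros <;> simp [smul_smul, mul_comm])]
  simp [co, Finsupp.single_apply]

variable (hχ : D.IsInvariantCharacter χ)
include hχ

/-- Left multiplication by `x` is passed through `ι_χ` as `x ι_χ(m) = ι_χ(x⁽¹⁾ ▷ m) x⁽²⁾`; cyclicity
then moves right multiplication by `x⁽²⁾` to the argument, which reduces the claim to
`trace_iota_slice` for the functional `f(- x)`. -/
lemma trace_mulLeft_iota_slice (f : H →ₗ[k] k) (x : H) (l : L) :
    LinearMap.trace k H
      (LinearMap.mulLeft k x ∘ₗ D.iota χ ∘ₗ antipodeAct k H l ∘ₗ sliceRight k f) =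
      f (D.iota χ (D.drinfeldInv l) * x) := by
  let F := antipodeAct k H l ∘ₗ sliceRight k f
  have h1 : LinearMap.mulLeft k x ∘ₗ D.iota χ ∘ₗ F =
      ∑ q, LinearMap.mulRight k (comulCoord k q x) ∘ₗ
        (D.iota χ ∘ₗ act k H L (Module.finBasis k H q) ∘ₗ F) := by
    ext g
    simp [mul_iota hχ, sw]
  -- On `g` the left side is `x⁽¹⁾ γ(x⁽²⁾) γ(g⁽¹⁾) ▷ l` with coefficient `f(g⁽²⁾ x⁽³⁾)`, so the
  -- first two legs of `x` cancel.
  have h2 : ∑ q, act k H L (Module.finBasis k H q) ∘ₗ F ∘ₗ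
        LinearMap.mulRight k (comulCoord k q x) =
      antipodeAct k H l ∘ₗ sliceRight k (f ∘ₗ LinearMap.mulRight k x) := by
    ext g
    simp only [LinearMap.sum_apply, LinearMap.comp_apply, LinearMap.mulRight_apply,
      antipodeAct_apply, F]
    change sw k (fun p q => p • antipode k (sliceRight k f (g * q)) • l) x = _
    trans sw k (fun p q => sw k (fun a b => sw k (fun c d =>
      f (b * d) • ((p * antipode k c) • antipode k a • l)) q) g) x
    · refine congrArg (fun F => sw k F x) (funext₂ fun p q => ?_)
      rw [sliceRight_apply, sw_mul k (f := fun a b => f b • a)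
        (by constructor <;> intros <;> simp [smul_smul, mul_comm])]
      simp [sw, antipode_mul_antidistrib, mul_smul, smul_assoc, smul_algebra_smul_comm (A := H),
        Finset.sum_smul]
    rw [sw_comm k (fun p q a b => sw k (fun c d =>
      f (b * d) • ((p * antipode k c) • antipode k a • l)) q)]
    trans sw k (fun a b => f (b * x) • antipode k a • l) g
    · refine congrArg (fun F => sw k F g) (funext₂ fun a b => ?_)
      rw [sw_assoc k (f := fun p c d => f (b * d) • ((p * antipode k c) • antipode k a • l))
        (by constructor <;> intros <;> simp [smul_assoc, smul_comm _ (f _),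
          mul_smul (_ : k) (_ : k)])]
      trans sw k (fun p d => Coalgebra.counit (R := k) p • f (b * d) • antipode k a • l) x
      · refine congrArg (fun F => sw k F x) (funext₂ fun p d => ?_)
        rw [sw_mul_antipode k (f := fun z => f (b * d) • (z • antipode k a • l))
          (by constructor <;> intros <;> simp [smul_assoc, smul_comm _ (f _)]), one_smul]
      · exact sw_counit_left k (f := fun d => f (b * d) • antipode k a • l)
          (by constructor <;> intros <;> simp [mul_smul]) x
    · rw [sliceRight_apply]
      simp [sw, smul_assoc, Finset.sum_smul]
  rw [h1, map_sum]
  have h4 : ∀ q, LinearMap.trace k H (LinearMap.mulRight k (comulCoord k q x) ∘ₗ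
      (D.iota χ ∘ₗ act k H L (Module.finBasis k H q) ∘ₗ F)) = LinearMap.trace k H
      ((D.iota χ ∘ₗ act k H L (Module.finBasis k H q) ∘ₗ F) ∘ₗ
        LinearMap.mulRight k (comulCoord k q x)) := fun q => trace_comp_comm k _ _
  simp only [h4]
  rw [← map_sum]
  have h3 := trace_iota_slice (D := D) (χ := χ) (f ∘ₗ LinearMap.mulRight k x) l
  rw [← h2] at h3
  rw [LinearMap.comp_apply, LinearMap.mulRight_apply] at h3
  rw [← h3]
  congr 1
  ext g
  simp

/-- The case `f = ε`, in which slicing is the identity and `ε ∘ ι_χ = χ`. -/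
lemma trace_mulLeft_iota (x : H) (l : L) :
    LinearMap.trace k H (LinearMap.mulLeft k x ∘ₗ D.iota χ ∘ₗ antipodeAct k H l) =
      Coalgebra.counit (R := k) x * D.adjointChar χ l := by
  have h := trace_mulLeft_iota_slice hχ (Coalgebra.counit (R := k) (A := H)) x l
  rw [counit_sliceRight, LinearMap.comp_id, Bialgebra.counit_mul, counit_iota] at h
  rw [h, mul_comm]; rfl

lemma trace_iota (l : L) :
    LinearMap.trace k H (D.iota χ ∘ₗ antipodeAct k H l) = D.adjointChar χ l := by
  have h := trace_mulLeft_iota hχ 1 l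
  simpa using h

/-- With `h = γ(x)`, available because the antipode is onto, `γ(g) h = γ(x g)`. Thus `h` turns into
left multiplication by `x` on the argument, which cyclicity moves to the value. -/
lemma adjointChar_smul (h : H) (l : L) :
    D.adjointChar χ (h • l) = Coalgebra.counit (R := k) h * D.adjointChar χ l := by
  rw [← antipode_antipodeInv k h, counit_antipode, ← trace_mulLeft_iota hχ, ← trace_iota hχ]
  generalize antipodeInv k H h = x
  rw [← trace_comp_comm]
  congr 1
  ext g
  simp [antipode_mul_antidistrib, mul_smul]

lemma adjointChar_one : D.adjointChar χ 1 = 1 := by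
  rw [← trace_iota hχ, trace_eq_sum]
  have h := apply_eq_sum k (Coalgebra.counit (R := k) (A := H)).isLinear 1
  rw [Bialgebra.counit_one] at h
  rw [h]
  refine Finset.sum_congr rfl fun i _ => ?_
  simp [Base.smul_one D, iota_one hχ, mul_comm]

/-- Here `ι_χ(γ(g) ▷ (l m)) = X(g⁽²⁾) ι_χ(γ(g⁽¹⁾) ▷ m)` with `X(h) = ι_χ(γ(h) ▷ l)`. Expanding
`X(g⁽²⁾)` in a basis and taking traces termwise leaves the trace of `X` followed by left
multiplication by `ι_χ(ϑ̄ ▷ m)`, which equals `χ(ϑ̄ ▷ m) χ̃(l)`. -/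
lemma adjointChar_mul (l m : L) :
    D.adjointChar χ (l * m) = D.adjointChar χ l * D.adjointChar χ m := by
  let X := D.iota χ ∘ₗ antipodeAct k H l
  have h1 : D.iota χ ∘ₗ antipodeAct k H (l * m) = ∑ j, LinearMap.mulLeft k
      (X (Module.finBasis k H j)) ∘ₗ D.iota χ ∘ₗ antipodeAct k H m ∘ₗ
        sliceRight k ((Module.finBasis k H).coord j) := by
    ext g
    simp only [LinearMap.comp_apply, antipodeAct_apply, smul_mul_eq D, LinearMap.sum_apply]
    rw [sw_antipode k (by constructor <;> intros <;> simp [smul_assoc]),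
      sw_map k (F := D.iota χ) (by constructor <;> intros <;> simp)]
    simp only [iota_mul hχ]
    trans sw k (fun a b => ∑ j, (Module.finBasis k H).coord j b •
      (X (Module.finBasis k H j) * D.iota χ (antipode k a • m))) g
    · refine congrArg (fun F => sw k F g) (funext₂ fun a b => ?_)
      exact apply_eq_sum k (F := fun b => X b * D.iota χ (antipode k a • m))
        (by constructor <;> intros <;> simp) b
    · simp only [sliceRight_apply, sw]
      rw [Finset.sum_comm]
      simp [Finset.sum_smul, smul_assoc]
  rw [← trace_iota hχ, h1, map_sum]
  simp only [trace_mulLeft_iota_slice hχ]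
  have h2 := trace_mulLeft_iota hχ (D.iota χ (D.drinfeldInv m)) l
  rw [counit_iota] at h2
  rw [mul_comm]
  refine Eq.trans ?_ h2
  rw [trace_eq_sum]
  rfl

lemma isInvariantCharacter_adjointChar : D.IsInvariantCharacter (D.adjointChar χ) :=
  ⟨adjointChar_one hχ, adjointChar_mul hχ, adjointChar_smul hχ⟩

end Base

/-! ### The map `ι_χ̃`, surjectivity of `ϑ̄`, and the space of generators. -/

namespace Base

open HopfAlgebra

attribute [local simp] mul_add add_mul smul_add add_smul TensorProduct.tmul_add
  TensorProduct.add_tmul TensorProduct.smul_tmul' Finset.sum_add_distrib Finset.smul_sum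

variable {k H L : Type*} [Field k] [Ring H] [HopfAlgebra k H] [FiniteDimensional k H]
  [Ring L] [Algebra k L] [Module H L] [IsScalarTower k H L] {D : Base k H L}
  {χ : L →ₗ[k] k}

lemma dualAct_apply (f : H →ₗ[k] k) (l : L) :
    D.dualAct f l = D.co (fun a m => f a • m) l := by
  conv_lhs => rw [dualAct, LinearMap.comp_apply, LinearMap.comp_apply, AlgHom.toLinearMap_apply,
    coact_eq_sum]
  simp [co]

/-- The contraction of `H ⊗ End H` underlying `ι_χ̃ = γ² ∘ ι_χ ∘ ϑ̄`. -/
lemma sum_coord_slice (f : H →ₗ[k] k) (X : H →ₗ[k] H) :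
    ∑ i, (Module.finBasis k H).coord i (sw k (fun q p => sw k (fun c b => sw k (fun a z =>
        f (antipode k (antipode k p) * a * antipode k c) • z) (X b)) q) (Module.finBasis k H i)) =
      LinearMap.trace k H (sliceRight k (f ∘ₗ antipode k ∘ₗ antipode k) ∘ₗ X) := by
  let e := Module.finBasis k H
  let g : H → H → H → k := fun p a c => f (antipode k (antipode k p) * a * antipode k c)
  -- `X(b)` is expanded as `∑ⱼ eʲ(b) X(eⱼ)`. Summation over `i` will later substitute the leg `z` of
  -- `X(eⱼ)` for the basis vector `eᵢ`.
  have h1 : ∀ i, e.coord i (sw k (fun q p => sw k (fun c b => sw k (fun a z =>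
        g p a c • z) (X b)) q) (e i)) = ∑ j, sw k (fun a z => e.coord i z •
          sw k (fun q p => sw k (fun c b => e.coord j b * g p a c) q) (e i)) (X (e j)) := by
    intro i
    have h : ∀ p c b, e.coord i (sw k (fun a z => g p a c • z) (X b)) =
        ∑ j, ∑ a, e.coord i (comulCoord k a (X (e j))) * (e.coord j b * g p (e a) c) := by
      intro p c b
      refine (apply_eq_sum k (F := fun b => e.coord i (sw k (fun a z => g p a c • z) (X b)))
        (by constructor <;> intros <;> simp [sw, mul_left_comm, Finset.mul_sum]) b).trans ?_
      refine Finset.sum_congr rfl fun j _ => ?_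
      simp only [sw, map_sum, map_smul, smul_eq_mul, Finset.mul_sum, e]
      exact Finset.sum_congr rfl fun a _ => by ring
    rw [sw_map k (F := e.coord i) (by constructor <;> intros <;> simp)]
    trans sw k (fun q p => sw k (fun c b =>
      ∑ j, ∑ a, e.coord i (comulCoord k a (X (e j))) * (e.coord j b * g p (e a) c)) q) (e i)
    · refine congrArg (fun F => sw k F (e i)) (funext₂ fun q p => ?_)
      rw [sw_map k (F := e.coord i) (by constructor <;> intros <;> simp)]
      exact congrArg (fun F => sw k F q) (funext₂ fun c b => h p c b)
    · simp only [sw, smul_eq_mul, Finset.mul_sum]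
      exact sum_comm₄ k _
  -- After the substitution `a γ(c)` is a product `u⁽¹⁾ γ(u⁽²⁾)` of neighbouring legs and cancels.
  have h2 : ∀ j u, e.coord j (sliceRight k (f ∘ₗ antipode k ∘ₗ antipode k) u) =
      sw k (fun a z => sw k (fun q p => sw k (fun c b => e.coord j b * g p a c) q) z) u := by
    intro j u
    symm
    let M : H → H → k := fun w y => sw k (fun b p =>
      e.coord j b * f (antipode k (antipode k p) * w)) y
    trans sw k (fun a z => sw k (fun c y => M (a * antipode k c) y) z) u
    · refine congrArg (fun F => sw k F u) (funext₂ fun a z => ?_)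
      rw [← sw_assoc k (f := fun c b p => e.coord j b * g p a c)
        (by constructor <;> intros <;> simp [g, mul_left_comm, mul_assoc])]
      simp only [M, g, mul_assoc]
    rw [sw_assoc k (f := fun a c y => M (a * antipode k c) y)
      (by constructor <;> intros <;> simp [M, sw, mul_left_comm, Finset.mul_sum])]
    trans sw k (fun a y => Coalgebra.counit (R := k) a • M 1 y) u
    · refine congrArg (fun F => sw k F u) (funext₂ fun a y => ?_)
      exact sw_mul_antipode k (f := fun w => M w y)
        (by constructor <;> intros <;> simp [M, sw, mul_left_comm, Finset.mul_sum]) a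
    rw [sw_counit_left k (f := M 1)
      (by constructor <;> intros <;> simp [M, sw, mul_left_comm, Finset.mul_sum]), sliceRight_apply]
    simp [M, sw, mul_comm]
  simp only [trace_eq_sum, LinearMap.comp_apply]
  refine (Finset.sum_congr rfl fun i _ => h1 i).trans ?_
  rw [Finset.sum_comm]
  refine Finset.sum_congr rfl fun j _ => ?_
  rw [h2]
  simp only [sw]
  rw [Finset.sum_comm]
  refine Finset.sum_congr rfl fun a _ => ?_
  symm
  exact apply_eq_sum k (F := fun z => sw k (fun q p => sw k (fun c b =>
      e.coord j b * g p (e a) c) q) z)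
    (by constructor <;> intros <;> simp [sw, g, Finset.mul_sum, mul_left_comm]) _

/-- `l⁽¹⁾ ⊗ h ▷ l^[∞]` expressed through `h⁽²⁾ ▷ l`. -/
lemma co_smul_right {W : Type*} [AddCommGroup W] [Module k W] {f : H → L → W} (hf : IsBilin k f)
    (h : H) (l : L) :
    D.co (fun a m => f a (h • m)) l = sw k (fun p q => sw k (fun b c =>
      D.co (fun a m => f (antipode k p * a * c) m) (b • l)) q) h := by
  let K : H → H → W := fun w b => D.co (fun a m => f (w * a) (b • m)) l
  have hK : IsBilin k K := by
    constructor <;> intros <;> simp [K, co, hf.add_left, hf.add_right, hf.smul_left,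
      hf.smul_right, smul_assoc]
  let E : H → H → H → H → H → W := fun p p' b c' c =>
    D.co (fun a m => f (antipode k p * p' * a * (antipode k c' * c)) (b • m)) l
  have h1 : ∀ p b c, D.co (fun a m => f (antipode k p * a * c) m) (b • l) =
      sw k (fun p' q' => sw k (fun b' c' => E p p' b' c' c) q') b := by
    intro p b c
    rw [co_smul_act D (f := fun a m => f (antipode k p * a * c) m)
      (by constructor <;> intros <;> simp [hf.add_left, hf.add_right, hf.smul_left,
      hf.smul_right])]
    simp only [E, mul_assoc]
  have h2 : ∀ p q, sw k (fun b c => sw k (fun p' q' => sw k (fun b' c' => E p p' b' c' c) q') b) q =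
      sw k (fun p' b => K (antipode k p * p') b) q := by
    intro p q
    rw [← sw_assoc k (f := fun p' q' c => sw k (fun b' c' => E p p' b' c' c) q')
      (by constructor <;> intros <;> simp [E, sw, co, hf.add_left, hf.smul_left])]
    refine congrArg (fun F => sw k F q) (funext₂ fun p' b => ?_)
    rw [← sw_assoc k (f := fun b' c' c => E p p' b' c' c)
      (by constructor <;> intros <;> simp [E, co, hf.add_left, hf.add_right, hf.smul_left,
        hf.smul_right, smul_assoc])]
    trans sw k (fun a y => Coalgebra.counit (R := k) y • K (antipode k p * p') a) b
    · refine congrArg (fun F => sw k F b) (funext₂ fun a y => ?_)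
      rw [sw_antipode_mul k (f := fun z =>
        D.co (fun a' m => f (antipode k p * p' * a' * z) (a • m)) l)
        (by constructor <;> intros <;> simp [co, hf.add_left, hf.smul_left])]
      simp only [mul_one, K]
    · exact sw_counit_right k (f := K (antipode k p * p'))
        (by constructor <;> intros <;> simp [hK.add_right, hK.smul_right]) b
  simp only [h1, h2]
  rw [sw_assoc k (f := fun p p' b => K (antipode k p * p') b)
    (by constructor <;> intros <;> simp [hK.add_left, hK.smul_left, hK.add_right, hK.smul_right])]
  trans sw k (fun a b => Coalgebra.counit (R := k) a • K 1 b) h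
  · rw [sw_counit_left k (f := K 1)
      (by constructor <;> intros <;> simp [hK.add_right, hK.smul_right])]
    simp only [K, one_mul]
  · refine congrArg (fun F => sw k F h) (funext₂ fun a b => ?_)
    exact (sw_antipode_mul k (f := fun w => K w b)
      (by constructor <;> intros <;> simp [hK.add_left, hK.smul_left]) a).symm

/-- `l⁽¹⁾ γ(z) ⊗ l^[∞]` expressed through `z⁽³⁾ ▷ l`. -/
lemma co_mul_antipode {W : Type*} [AddCommGroup W] [Module k W] {f : H → L → W}
    (hf : IsBilin k f) (z : H) (l : L) :
    D.co (fun a m => f (a * antipode k z) m) l = sw k (fun p q => sw k (fun b c =>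
      D.co (fun a m => f (antipode k b * a) (antipode k p • m)) (c • l)) q) z := by
  let K : H → H → H → W := fun x y c =>
    D.co (fun a m => f (x * a * antipode k c) (y • m)) l
  have hK : IsTrilin k K := by
    constructor <;> intros <;> simp [K, co, hf.add_left, hf.add_right, hf.smul_left,
      hf.smul_right, smul_assoc]
  have h1 : ∀ p b c, D.co (fun a m => f (antipode k b * a) (antipode k p • m)) (c • l) =
      sw k (fun p' q' => sw k (fun b' c' =>
        K (antipode k b * p') (antipode k p * b') c') q') c := by
    intro p b c
    rw [co_smul_act D (f := fun a m => f (antipode k b * a) (antipode k p • m))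
      (by constructor <;> intros <;> simp [hf.add_left, hf.add_right, hf.smul_left,
      hf.smul_right, smul_algebra_smul_comm (A := H)])]
    simp only [K, mul_assoc, mul_smul]
  have h2 : ∀ p q, sw k (fun b c => sw k (fun p' q' => sw k (fun b' c' =>
        K (antipode k b * p') (antipode k p * b') c') q') c) q =
      sw k (fun b' c' => K 1 (antipode k p * b') c') q := by
    intro p q
    rw [sw_assoc k (f := fun b p' q' => sw k (fun b' c' =>
        K (antipode k b * p') (antipode k p * b') c') q')
      (by constructor <;> intros <;> simp [sw, hK.add_left, hK.smul_left, hK.add_right,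
        hK.smul_right])]
    trans sw k (fun a y => Coalgebra.counit (R := k) a •
      sw k (fun b' c' => K 1 (antipode k p * b') c') y) q
    · refine congrArg (fun F => sw k F q) (funext₂ fun a y => ?_)
      exact sw_antipode_mul k (f := fun w => sw k (fun b' c' => K w (antipode k p * b') c') y)
        (by constructor <;> intros <;> simp [sw, hK.add_left, hK.smul_left]) a
    · exact sw_counit_left k (f := sw k (fun b' c' => K 1 (antipode k p * b') c'))
        (by constructor <;> intros <;> simp [sw, hK.add_right, hK.smul_right]) q
  simp only [h1, h2]
  rw [sw_assoc k (f := fun p b' c' => K 1 (antipode k p * b') c')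
    (by constructor <;> intros <;> simp [hK.add_mid, hK.smul_mid, hK.add_right, hK.smul_right])]
  trans sw k (fun a c => Coalgebra.counit (R := k) a • K 1 1 c) z
  · rw [sw_counit_left k (f := K 1 1)
      (by constructor <;> intros <;> simp [hK.add_right, hK.smul_right])]
    simp only [K, one_mul, one_smul]
  · refine congrArg (fun F => sw k F z) (funext₂ fun a c => ?_)
    exact (sw_antipode_mul k (f := fun w => K 1 w c)
      (by constructor <;> intros <;> simp [hK.add_mid, hK.smul_mid]) a).symm

variable (hχ : D.IsInvariantCharacter χ)

include hχ in
-- A functional `f` takes the value `χ̃(f ▷ l)` on `ι_χ̃(l)`, that is, the trace of `g ↦ ι_χ(γ(g) ▷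
-- (f ▷ l))`. The Yetter-Drinfeld condition (`co_smul_right`) moves the action of `γ(g)` inside the
-- coaction, after which `sum_coord_slice` and `trace_iota_slice` for `f ∘ γ²` evaluate the trace.
lemma iota_adjointChar (l : L) :
    D.iota (D.adjointChar χ) l = antipode k (antipode k (D.iota χ (D.drinfeldInv l))) := by
  refine (Module.finBasis k H).ext_elem fun i => ?_
  let f := (Module.finBasis k H).coord i
  change f _ = f _
  have h1 := trace_iota_slice (D := D) (χ := χ) (f ∘ₗ antipode k ∘ₗ antipode k) l
  rw [← LinearMap.comp_assoc, trace_comp_comm, ← sum_coord_slice, LinearMap.comp_apply,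
    LinearMap.comp_apply] at h1
  rw [← h1]
  have h2 : f (D.iota (D.adjointChar χ) l) = D.adjointChar χ (D.dualAct f l) := by
    rw [iota_apply, D.co_map f.isLinear, dualAct_apply, D.co_map (D.adjointChar χ).isLinear]
    simp [co, mul_comm]
  rw [h2, ← trace_iota hχ, trace_eq_sum]
  refine Finset.sum_congr rfl fun j _ => congrArg _ ?_
  generalize Module.finBasis k H j = g
  rw [LinearMap.comp_apply, antipodeAct_apply, dualAct_apply,
    D.co_map (F := fun m => D.iota χ (antipode k g • m))
      (by constructor <;> intros <;> simp [smul_algebra_smul_comm (A := H)])]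
  have h3 := D.co_smul_right (f := fun a m => f a • D.iota χ m)
    (by constructor <;> intros <;> simp [smul_smul, mul_comm]) (antipode k g) l
  trans D.co (fun a m => f a • D.iota χ (antipode k g • m)) l
  · simp [co, smul_algebra_smul_comm (A := H)]
  rw [h3]
  trans sw k (fun p q => sw k (fun b c => sw k (fun a z =>
    f (antipode k p * a * c) • z) (D.iota χ (b • l))) q) (antipode k g)
  · refine congrArg (fun F => sw k F _) (funext₂ fun p q => ?_)
    refine congrArg (fun F => sw k F _) (funext₂ fun b c => ?_)
    rw [sw_iota (f := fun a z => f (antipode k p * a * c) • z)]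
    constructor <;> intros <;> simp [smul_smul, mul_comm]
  rw [sw_antipode k (f := fun p q => sw k (fun b c => sw k (fun a z =>
    f (antipode k p * a * c) • z) (D.iota χ (b • l))) q)
    (by constructor <;> intros <;> simp [sw, smul_smul])]
  refine congrArg (fun F => sw k F _) (funext₂ fun q p => ?_)
  rw [sw_antipode k (f := fun b c => sw k (fun a z =>
    f (antipode k (antipode k p) * a * c) • z) (D.iota χ (b • l)))
    (by constructor <;> intros <;> simp [sw, smul_smul, mul_comm, smul_assoc])]
  rfl

section Surjective

/-- The inverse of `drinfeldInv`. -/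
def drinfeld (D : Base k H L) (l : L) : L :=
  ∑ i, D.dualAct ((Module.finBasis k H).coord i)
    (antipodeInv k H (antipodeInv k H (Module.finBasis k H i)) • l)

/-- Equivalently `ϑ` intertwines the action of `h` with that of `γ²(h)`. The factor `γ̄(z)` is
absorbed by replacing `eⱼ` with `eⱼ γ(z)`; by duality this multiplies the coaction leg by `γ(z)`,
and `co_mul_antipode` converts that into actions on both sides, of which only `γ(z)` survives. -/
lemma antipode_smul_drinfeld (z : H) (l : L) :
    antipode k z • D.drinfeld l = D.drinfeld (antipodeInv k H z • l) := by
  let e := Module.finBasis k H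
  let s : H → H := fun x => antipodeInv k H (antipodeInv k H x)
  have h1 : D.drinfeld (antipodeInv k H z • l) =
      ∑ i, D.co (fun a n => e.coord i (a * antipode k z) • n) (s (e i) • l) := by
    have h : ∀ j, D.dualAct (e.coord j) (s (e j) • antipodeInv k H z • l) =
        ∑ i, e.coord i (e j * antipode k z) • D.dualAct (e.coord j) (s (e i) • l) := by
      intro j
      have h := apply_eq_sum k (F := fun x => D.dualAct (e.coord j) (s x • l))
        (by constructor <;> intros <;> simp [s, smul_assoc]) (e j * antipode k z)
      rw [← h]
      simp only [s, antipodeInv_mul, antipodeInv_antipode, mul_smul]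
    simp only [drinfeld]
    refine (Finset.sum_congr rfl fun j _ => h j).trans ?_
    rw [Finset.sum_comm]
    rfl
  have h2 : ∀ i, D.co (fun a n => e.coord i (a * antipode k z) • n) (s (e i) • l) =
      sw k (fun p q => sw k (fun b c => D.co (fun a n =>
        e.coord i (antipode k b * a) • antipode k p • n) (c • s (e i) • l)) q) z := fun i =>
    D.co_mul_antipode (f := fun a n => e.coord i a • n)
      (by constructor <;> intros <;> simp [smul_smul, mul_comm]) z (s (e i) • l)
  have h3 : ∀ p b c : H, ∑ i, D.co (fun a n =>
        e.coord i (antipode k b * a) • antipode k p • n) (c • s (e i) • l) =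
      ∑ j, antipode k p • D.dualAct (e.coord j) ((c * antipodeInv k H b) • s (e j) • l) := by
    intro p b c
    simp only [co]
    rw [Finset.sum_comm]
    refine Finset.sum_congr rfl fun j _ => ?_
    have h := apply_eq_sum k (F := fun x => antipode k p • D.dualAct (e.coord j) (c • s x • l))
      (by constructor <;> intros <;> simp [s, smul_assoc, smul_algebra_smul_comm (A := H)])
      (antipode k b * e j)
    refine h.symm.trans ?_
    simp only [s, antipodeInv_mul, antipodeInv_antipode, mul_smul]
  rw [h1]
  simp only [h2]
  trans sw k (fun p q => sw k (fun b c => ∑ i, D.co (fun a n =>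
        e.coord i (antipode k b * a) • antipode k p • n) (c • s (e i) • l)) q) z
  · simp only [h3]
    trans sw k (fun p q => Coalgebra.counit (R := k) q • antipode k p • D.drinfeld l) z
    · exact (sw_counit_right k (f := fun p => antipode k p • D.drinfeld l)
        (by constructor <;> intros <;> simp [smul_assoc]) z).symm
    · refine congrArg (fun F => sw k F z) (funext₂ fun p q => ?_)
      rw [sw_mul_antipodeInv k (f := fun w =>
        ∑ j, antipode k p • D.dualAct (e.coord j) (w • s (e j) • l))
        (by constructor <;> intros <;> simp [smul_assoc, smul_algebra_smul_comm (A := H)])]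
      simp only [one_smul, drinfeld, Finset.smul_sum, e, s]
  · simp only [sw_sum]

/-- Coassociativity of the coaction: the inner functional is evaluated on the first leg of the
coproduct, the outer one on the second. -/
lemma dualAct_dualAct (i j : Fin (Module.finrank k H)) (l : L) :
    D.dualAct ((Module.finBasis k H).coord j) (D.dualAct ((Module.finBasis k H).coord i) l) =
      ∑ p, (Module.finBasis k H).coord j (comulCoord k i (Module.finBasis k H p)) •
        D.dualAct ((Module.finBasis k H).coord p) l := by
  let e := Module.finBasis k H
  have h := D.co_assoc (f := fun a b n => e.coord i a • e.coord j b • n)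
    (by constructor <;> intros <;> simp [smul_smul, mul_comm, mul_left_comm]) l
  trans D.co (fun a m => D.co (fun b n => e.coord i a • e.coord j b • n) m) l
  · simp [co, e, Finsupp.single_apply]
  · rw [h]
    simp [co, sw, e, Finsupp.single_apply]

/-- Moving `γ(hᵢ)` past `ϑ` and composing the two dual actions leaves `γ̄(h⁽²⁾ γ̄(h⁽¹⁾))`, which is
the counit. -/
lemma drinfeldInv_drinfeld (l : L) : D.drinfeldInv (D.drinfeld l) = l := by
  let e := Module.finBasis k H
  rw [drinfeldInv_apply]
  simp only [antipode_smul_drinfeld]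
  simp only [drinfeld, map_sum, dualAct_dualAct, ← mul_smul, ← antipodeInv_mul]
  trans ∑ p, D.dualAct (e.coord p) (sw k (fun a b => antipodeInv k H (b * antipodeInv k H a)
      • l) (e p))
  · simp only [sw, map_sum]
    rw [Finset.sum_comm]
    conv_rhs => rw [Finset.sum_comm]
    refine Finset.sum_congr rfl fun j _ => ?_
    rw [Finset.sum_comm]
    refine Finset.sum_congr rfl fun p _ => ?_
    exact (apply_eq_sum k (F := fun x => D.dualAct (e.coord p)
      (antipodeInv k H (x * antipodeInv k H (e j)) • l))
      (by constructor <;> intros <;> simp [smul_assoc]) _).symm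
  · have h : ∀ p, sw k (fun a b => antipodeInv k H (b * antipodeInv k H a) • l) (e p) =
        Coalgebra.counit (R := k) (e p) • l := by
      intro p
      rw [sw_mul_antipodeInv k (f := fun z => antipodeInv k H z • l)
        (by constructor <;> intros <;> simp [smul_assoc]), antipodeInv_one, one_smul]
    simp only [h, map_smul]
    exact D.co_counit (f := id) (by constructor <;> intros <;> simp) l

lemma drinfeldInv_surjective : Function.Surjective D.drinfeldInv :=
  fun l => ⟨D.drinfeld l, drinfeldInv_drinfeld l⟩

end Surjective

/-! ### Generators tested through the antipode. -/

section Generators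

variable {V : Type*} [AddCommGroup V] [Module k V] [Module H V] [IsScalarTower k H V]

/-- Applying `γ(h⁽¹⁾) h⁽²⁾ = ε(h)` to `h = ι_χ(l)` gives `χ(l) v = γ(l⁽¹⁾) ι_χ(l^[∞]) ▷ v`, in which
`ι_χ(l^[∞])` may be replaced by `χ(l^[∞])`. The converse uses `h⁽¹⁾ γ(h⁽²⁾)` in the same way. -/
lemma antipode_iota_smul {v : V} (hv : v ∈ D.generators χ V) (l : L) :
    antipode k (D.iota χ l) • v = χ l • v := by
  have h := sw_antipode_mul k (f := fun z => z • v)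
    (by constructor <;> intros <;> simp [smul_assoc]) (D.iota χ l)
  rw [counit_iota, one_smul, sw_iota (f := fun a b => (antipode k a * b) • v)
    (by constructor <;> intros <;> simp [smul_assoc])] at h
  rw [← h, iota_apply, D.co_map (F := fun z => antipode k z • v)
    (by constructor <;> intros <;> simp [smul_assoc])]
  refine congrArg (fun F => D.co F l) (funext₂ fun a m => ?_)
  rw [mul_smul, hv m]
  simp [smul_assoc, smul_algebra_smul_comm (A := H)]

lemma mem_generators_of_antipode {v : V}
    (hv : ∀ l, antipode k (D.iota χ l) • v = χ l • v) : v ∈ D.generators χ V := by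
  intro l
  have h := sw_mul_antipode k (f := fun z => z • v)
    (by constructor <;> intros <;> simp [smul_assoc]) (D.iota χ l)
  rw [counit_iota, one_smul, sw_iota (f := fun a b => (a * antipode k b) • v)
    (by constructor <;> intros <;> simp [smul_assoc])] at h
  rw [← h, iota_apply, D.co_map (F := fun z => z • v)
    (by constructor <;> intros <;> simp [smul_assoc])]
  refine congrArg (fun F => D.co F l) (funext₂ fun a m => ?_)
  rw [mul_smul, hv m]
  simp [smul_assoc, smul_algebra_smul_comm (A := H)]

/-- The elements `ϑ̄ ▷ l` exhaust `L`, and `χ(ϑ̄ ▷ l)` is `χ̃(l)`. This is the form in which the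
condition appears on the right module. -/
lemma mem_generators_iff_adjoint (v : V) : v ∈ D.generators χ V ↔
    ∀ l, antipode k (D.iota χ (D.drinfeldInv l)) • v = D.adjointChar χ l • v := by
  refine ⟨fun hv l => antipode_iota_smul hv _, fun hv => mem_generators_of_antipode fun l => ?_⟩
  obtain ⟨l, rfl⟩ := drinfeldInv_surjective (D := D) l
  exact hv l

include hχ in
-- The rule `ι_χ(l) h = h⁽²⁾ ι_χ(γ̄(h⁽¹⁾) ▷ l)` moves `h` to the left of `ι_χ`, and invariance of
-- `χ` removes `γ̄(h⁽¹⁾)`.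
lemma smul_mem_generators {v : V} (hv : v ∈ D.generators χ V) (h : H) :
    h • v ∈ D.generators χ V := by
  intro l
  rw [← mul_smul, iota_mul_eq hχ,
    sw_map k (F := fun z => z • v) (by constructor <;> intros <;> simp [smul_assoc])]
  have h1 : ∀ a, χ (antipodeInv k H a • l) = Coalgebra.counit (R := k) a * χ l := by
    intro a
    rw [hχ.invariant, ← counit_antipode (R := k), antipode_antipodeInv]
  have h2 : ∀ a b : H, (b * D.iota χ (antipodeInv k H a • l)) • v =
      Coalgebra.counit (R := k) a • (χ l • b • v) := by
    intro a b
    rw [mul_smul, hv, h1, mul_smul, smul_algebra_smul_comm (A := H),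
      smul_algebra_smul_comm (A := H)]
  simp only [h2]
  exact sw_counit_left k (f := fun b => χ l • b • v)
    (by constructor <;> intros <;> simp [smul_assoc, smul_comm _ (χ l)]) h

end Generators

end Base

/-! ### The two projections of `A ⊗ L` to `A`, and their agreement. -/

namespace DynAlgebra

open HopfAlgebra Base

attribute [local simp] mul_add add_mul smul_add add_smul TensorProduct.tmul_add
  TensorProduct.add_tmul TensorProduct.smul_tmul' Finset.sum_add_distrib Finset.smul_sum

variable {k H L A : Type*} [Field k] [Ring H] [HopfAlgebra k H] [FiniteDimensional k H]
  [Ring L] [Algebra k L] [Module H L] [IsScalarTower k H L] {D : Base k H L}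
  [AddCommGroup A] [Module k A] [Module H A] [IsScalarTower k H A]
  (𝒜 : DynAlgebra D A) {χ : L →ₗ[k] k}

section Evaluation

variable (k L A) in
/-- `a ⊗ l ↦ f(l) a`. -/
def evalRight (f : L →ₗ[k] k) : A ⊗[k] L →ₗ[k] A :=
  (TensorProduct.rid k A).toLinearMap ∘ₗ LinearMap.lTensor A f

omit [FiniteDimensional k H] in
@[simp]
lemma evalRight_tmul (f : L →ₗ[k] k) (a : A) (l : L) :
    evalRight k L A f (a ⊗ₜ l) = f l • a := by
  simp [evalRight]

/-- The projection `B → A`, `l a ↦ f(l) a`. -/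
def evalLeft (f : L →ₗ[k] k) : A ⊗[k] L →ₗ[k] A :=
  (TensorProduct.lid k A).toLinearMap ∘ₗ LinearMap.rTensor A f ∘ₗ 𝒜.toLA

lemma braid_tmul (l : L) (a : A) :
    D.braid A (l ⊗ₜ a) = D.co (fun h m => (h • a) ⊗ₜ[k] m) l := by
  simp [braid_eq, coact_eq_sum D l, co]

lemma toLA_tmul (a : A) (l : L) :
    𝒜.toLA (a ⊗ₜ l) = D.co (fun h m => m ⊗ₜ[k] (antipodeInv k H h • a)) l := by
  simp only [toLA, LinearMap.comp_apply, LinearEquiv.coe_coe, TensorProduct.comm_tmul,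
    LinearMap.rTensor_tmul, AlgHom.toLinearMap_apply]
  rw [coact_eq_sum D l]
  simp [co, TensorProduct.sum_tmul]

lemma braid_toLA (z : A ⊗[k] L) : D.braid A (𝒜.toLA z) = z := by
  induction z with
  | zero => simp
  | add x y hx hy => rw [map_add, map_add, hx, hy]
  | tmul a l =>
    rw [toLA_tmul, D.co_map (D.braid A).isLinear]
    simp only [braid_tmul, ← mul_smul]
    rw [D.co_assoc (f := fun h h' n => ((h' * antipodeInv k H h) • a) ⊗ₜ[k] n)
      (by constructor <;> intros <;> simp [smul_assoc])]
    refine Eq.trans ?_ (D.co_counit (f := fun m => a ⊗ₜ[k] m)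
      (by constructor <;> intros <;> simp) l)
    refine congrArg (fun F => D.co F l) (funext₂ fun h m => ?_)
    rw [sw_mul_antipodeInv k (f := fun w => (w • a) ⊗ₜ[k] m)
      (by constructor <;> intros <;> simp [smul_assoc]), one_smul]

lemma toLA_braid (z : L ⊗[k] A) : 𝒜.toLA (D.braid A z) = z := by
  induction z with
  | zero => simp
  | add x y hx hy => rw [map_add, map_add, hx, hy]
  | tmul l a =>
    rw [braid_tmul, D.co_map 𝒜.toLA.isLinear]
    simp only [toLA_tmul, ← mul_smul]
    rw [D.co_assoc (f := fun h h' n => n ⊗ₜ[k] ((antipodeInv k H h' * h) • a))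
      (by constructor <;> intros <;> simp [smul_assoc])]
    refine Eq.trans ?_ (D.co_counit (f := fun m => m ⊗ₜ[k] a)
      (by constructor <;> intros <;> simp) l)
    refine congrArg (fun F => D.co F l) (funext₂ fun h m => ?_)
    rw [sw_antipodeInv_mul k (f := fun w => m ⊗ₜ[k] (w • a))
      (by constructor <;> intros <;> simp [smul_assoc]), one_smul]

lemma evalLeft_braid (f : L →ₗ[k] k) (l : L) (a : A) :
    𝒜.evalLeft f (D.braid A (l ⊗ₜ a)) = f l • a := by
  simp [evalLeft, toLA_braid]

lemma evalLeft_tmul (f : L →ₗ[k] k) (a : A) (l : L) :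
    𝒜.evalLeft f (a ⊗ₜ l) = antipodeInv k H (D.iota f l) • a := by
  rw [evalLeft, LinearMap.comp_apply, LinearMap.comp_apply, toLA_tmul, iota_apply,
    D.co_map (F := fun h => antipodeInv k H h • a)
      (by constructor <;> intros <;> simp [smul_assoc])]
  simp [co, smul_assoc]

/-- The projection of `A ⊗ L` to `A` along `χ` on the elements on which `γ(ι_χ(l))` acts
as `χ(l)`. -/
lemma evalLeft_adjointChar_eq (hχ : D.IsInvariantCharacter χ) {s : A ⊗[k] L}
    (hs : ∀ l, diagAct k H A L (antipode k (D.iota χ l)) s = χ l • s) :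
    𝒜.evalLeft (D.adjointChar χ) s = evalRight k L A χ s := by
  let e := Module.finBasis k H
  let ω : Fin (Module.finrank k H) → L →ₗ[k] k := fun i => e.coord i ∘ₗ D.iota χ
  -- The left projection is written through right projections along the coordinates `ωᵢ` of `ι_χ`.
  -- One antipode of `ι_χ̃ = γ² ι_χ ϑ̄` cancels `γ̄`; the other reverses the coproduct and so fits
  -- the diagonal action.
  have h1 : ∀ z, 𝒜.evalLeft (D.adjointChar χ) z =
      ∑ i, evalRight k L A (ω i) (diagAct k H A L (antipode k (e i)) z) := by
    intro z
    induction z with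
    | zero => simp
    | add x y hx hy => simp only [map_add, hx, hy, Finset.sum_add_distrib]
    | tmul a l =>
      have h2 : D.iota χ (D.drinfeldInv l) =
          ∑ i, sw k (fun p q => ω i (antipode k p • l) • q) (e i) := by
        refine e.ext_elem fun j => ?_
        change e.coord j _ = e.coord j _
        rw [← trace_iota_slice, trace_eq_sum, map_sum]
        refine Finset.sum_congr rfl fun i _ => ?_
        simp only [LinearMap.comp_apply, sliceRight_apply]
        simp [sw, ω, e, mul_comm]
      rw [evalLeft_tmul, iota_adjointChar hχ, antipodeInv_antipode, h2, map_sum, Finset.sum_smul]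
      refine Finset.sum_congr rfl fun i _ => ?_
      rw [sw_map k (F := fun z => antipode k z • a)
        (by constructor <;> intros <;> simp [smul_assoc])]
      have h3 : diagAct k H A L (antipode k (e i)) (a ⊗ₜ l) =
          sw k (fun p q => (antipode k q • a) ⊗ₜ[k] (antipode k p • l)) (e i) := by
        rw [diagAct_eq, comul_antipode]
        simp [sw]
      rw [h3, sw_map k (evalRight k L A (ω i)).isLinear]
      simp [sw, smul_assoc]
  -- The hypothesis on `s` concerns only the image of `ι_χ`, whereas the `eᵢ` run over all of `H`. A
  -- linear section of `ι_χ`, extended to `H`, rewrites `∑ᵢ ωᵢ ⊗ eᵢ` with second factors in that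
  -- image.
  obtain ⟨σ, hσ⟩ : ∃ σ : H →ₗ[k] L, ∀ l, D.iota χ (σ (D.iota χ l)) = D.iota χ l := by
    obtain ⟨g, hg⟩ := (D.iota χ).rangeRestrict.exists_rightInverse_of_surjective
      (LinearMap.range_rangeRestrict _)
    obtain ⟨σ, hσ⟩ := g.exists_extend
    refine ⟨σ, fun l => ?_⟩
    have h2 := LinearMap.congr_fun hσ ((D.iota χ).rangeRestrict l)
    have h3 := congrArg Subtype.val (LinearMap.congr_fun hg ((D.iota χ).rangeRestrict l))
    change σ (D.iota χ l) = _ at h2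
    change D.iota χ (g _) = D.iota χ l at h3
    rw [h2, h3]
  have hω : ∀ i, ω i = ∑ j, e.coord i (D.iota χ (σ (e j))) • ω j := by
    intro i
    ext l
    have h2 := apply_eq_sum k (e.coord i ∘ₗ D.iota χ ∘ₗ σ).isLinear (D.iota χ l)
    simp only [LinearMap.comp_apply, hσ] at h2
    simp only [LinearMap.sum_apply, LinearMap.smul_apply, ω, LinearMap.comp_apply, h2, smul_eq_mul]
    exact Finset.sum_congr rfl fun j _ => mul_comm _ _
  -- `χ` factors through `ι_χ` as `ε ∘ ι_χ`, so the choice of section does not affect its value.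
  have hX : ∑ j, χ (σ (e j)) • ω j = χ := by
    ext l
    have h2 := apply_eq_sum k (χ ∘ₗ σ).isLinear (D.iota χ l)
    have h3 : χ (σ (D.iota χ l)) = χ l := by
      rw [← counit_iota (D := D) (χ := χ), hσ, counit_iota]
    simp only [LinearMap.comp_apply, h3] at h2
    simp only [LinearMap.sum_apply, LinearMap.smul_apply, ω, LinearMap.comp_apply, smul_eq_mul]
    rw [h2]
    exact Finset.sum_congr rfl fun j _ => mul_comm _ _
  have hlin : ∀ (c : Fin (Module.finrank k H) → k) (z : A ⊗[k] L),
      evalRight k L A (∑ j, c j • ω j) z = ∑ j, c j • evalRight k L A (ω j) z := by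
    intro c z
    induction z with
    | zero => simp
    | add x y hx hy => simp only [map_add, smul_add, hx, hy, Finset.sum_add_distrib]
    | tmul a l => simp [Finset.sum_smul, mul_smul]
  rw [h1]
  calc _ = ∑ i, ∑ j, e.coord i (D.iota χ (σ (e j))) •
        evalRight k L A (ω j) (diagAct k H A L (antipode k (e i)) s) := by
        refine Finset.sum_congr rfl fun i _ => ?_
        conv_lhs => rw [hω i, hlin]
    _ = ∑ j, evalRight k L A (ω j) (diagAct k H A L (antipode k (D.iota χ (σ (e j)))) s) := by
        rw [Finset.sum_comm]
        refine Finset.sum_congr rfl fun j _ => ?_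
        exact (apply_eq_sum k (F := fun x =>
          evalRight k L A (ω j) (diagAct k H A L (antipode k x) s))
          (by constructor <;> intros <;> simp) _).symm
    _ = _ := by
        simp only [hs, map_smul]
        rw [← hlin, hX]

omit [FiniteDimensional k H] in
lemma star_apply (f : L →ₗ[k] k) (a b : A) :
    𝒜.star f a b = evalRight k L A f (𝒜.mul (a ⊗ₜ b)) := rfl

omit [FiniteDimensional k H] in
lemma rdot_apply (f : L →ₗ[k] k) (a b : A) :
    𝒜.rdot f a b = 𝒜.evalLeft f (𝒜.mul (a ⊗ₜ b)) := rfl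

lemma diagAct_tmul {M N : Type*} [AddCommGroup M] [Module k M] [Module H M] [IsScalarTower k H M]
    [AddCommGroup N] [Module k N] [Module H N] [IsScalarTower k H N] (h : H) (m : M) (n : N) :
    diagAct k H M N h (m ⊗ₜ n) = sw k (fun a b => (a • m) ⊗ₜ[k] (b • n)) h := by
  rw [diagAct_eq, comul_eq_sum]
  simp [sw]

/-- Equivariance turns the action of `γ(ι_χ(l))` on `a ⋇ b` into `(γ(ι_χ(l^[∞])) ▷ a) ⋇ (γ(l⁽¹⁾) ▷
b)`. The generator `a` replaces the first antipode by `χ(l^[∞])`, and then `b` sees `γ(ι_χ(l))`. -/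
lemma star_eq_rdot (hχ : D.IsInvariantCharacter χ) {a b : A} (ha : a ∈ D.generators χ A)
    (hb : b ∈ D.generators χ A) : 𝒜.star χ a b = 𝒜.rdot (D.adjointChar χ) a b := by
  rw [star_apply, rdot_apply]
  refine (𝒜.evalLeft_adjointChar_eq hχ fun l => ?_).symm
  rw [← 𝒜.equivariant, diagAct_tmul, sw_antipode k
    (by constructor <;> intros <;> simp [smul_assoc]), sw_iota
    (f := fun p q => (antipode k q • a) ⊗ₜ[k] (antipode k p • b))
    (by constructor <;> intros <;> simp [smul_assoc]), ← map_smul]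
  congr 1
  simp only [antipode_iota_smul ha]
  have h1 := antipode_iota_smul hb l
  rw [iota_apply, D.co_map (F := fun z => antipode k z • b)
    (by constructor <;> intros <;> simp [smul_assoc])] at h1
  rw [← TensorProduct.tmul_smul, ← h1, D.co_map (F := fun z => a ⊗ₜ[k] z)
    (by constructor <;> intros <;> simp)]
  simp [smul_assoc]

lemma smul_evalRight (hχ : D.IsInvariantCharacter χ) (h : H) (z : A ⊗[k] L) :
    h • evalRight k L A χ z = evalRight k L A χ (diagAct k H A L h z) := by
  induction z with
  | zero => simp
  | add x y hx hy => simp only [map_add, smul_add, hx, hy]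
  | tmul a l =>
    rw [diagAct_tmul, sw_map k (evalRight k L A χ).isLinear, evalRight_tmul]
    simp only [evalRight_tmul, hχ.invariant, mul_smul]
    rw [sw_counit_right k (f := fun p => χ l • p • a)
      (by constructor <;> intros <;> simp [smul_assoc, smul_comm _ (χ l)]),
      smul_algebra_smul_comm]

lemma smul_star (hχ : D.IsInvariantCharacter χ) (h : H) (a b : A) :
    h • 𝒜.star χ a b = TensorProduct.lift (𝒜.star χ) (diagAct k H A A h (a ⊗ₜ b)) := by
  rw [star_apply, smul_evalRight hχ, ← 𝒜.equivariant]
  generalize diagAct k H A A h (a ⊗ₜ b) = z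
  induction z with
  | zero => simp
  | add x y hx hy => simp only [map_add, hx, hy]
  | tmul x y => rfl

omit [FiniteDimensional k H] in
lemma smul_one_eq (hχ : D.IsInvariantCharacter χ) (h : H) :
    h • 𝒜.one = Coalgebra.counit (R := k) h • 𝒜.one := by
  have := congrArg (evalRight k L A χ) (𝒜.smul_one_tmul h)
  simpa [hχ.map_one] using this

lemma one_mem_generators (hχ : D.IsInvariantCharacter χ) : 𝒜.one ∈ D.generators χ A := by
  intro l
  rw [𝒜.smul_one_eq hχ, counit_iota]

end Evaluation

end DynAlgebra

/-! ### The induced modules and their endomorphisms. -/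

namespace DynAlgebra

open HopfAlgebra Base

variable {k H L A : Type*} [Field k] [Ring H] [HopfAlgebra k H]
  [Ring L] [Algebra k L] [Module H L] [IsScalarTower k H L] {D : Base k H L}
  [AddCommGroup A] [Module k A] [Module H A] [IsScalarTower k H A]
  (𝒜 : DynAlgebra D A) {χ : L →ₗ[k] k}

section SmashProduct

lemma leftA_one : 𝒜.leftA 𝒜.one = 1 :=
  TensorProduct.ext' fun a l => by rw [leftA_tmul, 𝒜.one_mul, absorb_tmul, _root_.one_mul]; rfl

lemma leftL_one : 𝒜.leftL 1 = 1 := by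
  have h := 𝒜.smashMul_one_left
  rwa [smashMul_tmul, leftA_one, _root_.one_mul] at h

lemma mk_add (a b : A) (l : L) : Smash.mk 𝒜 (a + b) l = Smash.mk 𝒜 a l + Smash.mk 𝒜 b l :=
  TensorProduct.add_tmul a b l

lemma mk_smul (c : k) (a : A) (l : L) : Smash.mk 𝒜 (c • a) l = c • Smash.mk 𝒜 a l := rfl

lemma mk_one_one : Smash.mk 𝒜 𝒜.one 1 = 1 := rfl

lemma mk_mul_mk_one (a b : A) : Smash.mk 𝒜 a 1 * Smash.mk 𝒜 b 1 = 𝒜.mul (a ⊗ₜ b) := by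
  change 𝒜.smashMul (a ⊗ₜ 1) (b ⊗ₜ 1) = _
  rw [smashMul_tmul, leftL_one, _root_.mul_one, leftA_tmul, absorb_one]

lemma mk_one_mul (l : L) (b : 𝒜.Smash) : Smash.mk 𝒜 𝒜.one l * b = 𝒜.leftL l b := by
  change 𝒜.smashMul (𝒜.one ⊗ₜ l) b = _
  rw [smashMul_tmul, leftA_one, _root_.one_mul]

lemma mul_mk_one (b : 𝒜.Smash) (l : L) : b * Smash.mk 𝒜 𝒜.one l = absorb k L A (b ⊗ₜ[k] l) := by
  have h : (𝒜.one ⊗ₜ[k] l : A ⊗[k] L) = absorb k L A ((𝒜.one ⊗ₜ 1) ⊗ₜ l) := by simp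
  refine (congrArg (𝒜.smashMul b) h).trans ?_
  exact (𝒜.smashMul_absorb_right b _ l).trans
    (congrArg (fun t => absorb k L A (t ⊗ₜ l)) (𝒜.smashMul_one_right b))

lemma mk_mul_one (a : A) (l : L) : Smash.mk 𝒜 a 1 * Smash.mk 𝒜 𝒜.one l = Smash.mk 𝒜 a l := by
  rw [mul_mk_one]
  change absorb k L A ((a ⊗ₜ 1) ⊗ₜ l) = a ⊗ₜ l
  rw [absorb_tmul, _root_.one_mul]

lemma mk_one_mul_mk (a : A) (l : L) : Smash.mk 𝒜 𝒜.one l * Smash.mk 𝒜 a 1 = D.braid A (l ⊗ₜ a) := by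
  rw [mk_one_mul]
  change 𝒜.leftL l (a ⊗ₜ 1) = _
  rw [leftL_tmul, absorb_one]

variable {𝒜} in
@[elab_as_elim]
lemma smash_induction {p : 𝒜.Smash → Prop} (b : 𝒜.Smash) (zero : p 0)
    (mk : ∀ a l, p (Smash.mk 𝒜 a l)) (add : ∀ x y, p x → p y → p (x + y)) : p b :=
  TensorProduct.induction_on (motive := p) b zero mk add

end SmashProduct

/-! ### The left module `A_χ`. -/

section LeftModule

/-- The projection `B → A`, `a l ↦ χ(l) a`. -/
def leftProj (χ : L →ₗ[k] k) : 𝒜.Smash →ₗ[k] A := evalRight k L A χ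

lemma leftProj_mk (a : A) (l : L) : 𝒜.leftProj χ (Smash.mk 𝒜 a l) = χ l • a := evalRight_tmul ..

lemma leftProj_mul (hχ : D.IsInvariantCharacter χ) (b : 𝒜.Smash) (l : L) :
    𝒜.leftProj χ (b * Smash.mk 𝒜 𝒜.one l) = χ l • 𝒜.leftProj χ b := by
  induction b using smash_induction with
  | zero => simp
  | add x y hx hy => rw [add_mul, map_add, map_add, hx, hy, smul_add]
  | mk a m =>
    rw [mul_mk_one]
    change evalRight k L A χ (absorb k L A ((a ⊗ₜ m) ⊗ₜ l)) = χ l • evalRight k L A χ (a ⊗ₜ m)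
    rw [absorb_tmul, evalRight_tmul, evalRight_tmul, hχ.map_mul, smul_smul, mul_comm]

lemma leftProj_mul_mk_one (a b : A) : 𝒜.leftProj χ (Smash.mk 𝒜 a 1 * Smash.mk 𝒜 b 1) =
      𝒜.star χ a b := by
  rw [mk_mul_mk_one]
  rfl

lemma leftProj_mk_one_mul (l : L) (a : A) :
    𝒜.leftProj χ (Smash.mk 𝒜 𝒜.one l * Smash.mk 𝒜 a 1) = D.iota χ l • a := by
  rw [mk_one_mul_mk, braid_eq]
  change evalRight k L A χ _ = (TensorProduct.rid k H (LinearMap.lTensor H χ (D.coact l))) • a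
  induction D.coact l with
  | zero => simp
  | add x y hx hy => simp only [map_add, add_smul, hx, hy]
  | tmul h n => simp [smul_assoc]

lemma toLeft_leftProj (b : 𝒜.Smash) :
    𝒜.toLeft χ (𝒜.leftProj χ b) = Submodule.Quotient.mk b := by
  induction b using smash_induction with
  | zero =>
    rw [map_zero]
    exact congrArg _ (TensorProduct.zero_tmul A (1 : L))
  | add x y hx hy =>
    rw [map_add, toLeft, mk_add, Submodule.Quotient.mk_add, Submodule.Quotient.mk_add, ← hx, ← hy]
    rfl
  | mk a l =>
    refine ((Submodule.Quotient.eq _).2 ?_).symm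
    have h : Smash.mk 𝒜 a l - Smash.mk 𝒜 (𝒜.leftProj χ (Smash.mk 𝒜 a l)) 1 =
        Smash.mk 𝒜 a 1 • (Smash.mk 𝒜 𝒜.one l - χ l • (1 : 𝒜.Smash)) := by
      rw [leftProj_mk, mk_smul, smul_eq_mul, mul_sub, mk_mul_one, mul_smul_comm, _root_.mul_one]
    rw [h]
    exact Submodule.smul_mem _ _ (Submodule.subset_span ⟨l, rfl⟩)

lemma quotient_mk_eq_zero_iff (hχ : D.IsInvariantCharacter χ) (b : 𝒜.Smash) :
    (Submodule.Quotient.mk b : 𝒜.LeftInduced χ) = 0 ↔ 𝒜.leftProj χ b = 0 := by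
  constructor
  · intro hb
    rw [Submodule.Quotient.mk_eq_zero] at hb
    -- The projection is not `B`-linear, so the induction over the left ideal needs all left
    -- multiples at once.
    suffices ∀ c : 𝒜.Smash, 𝒜.leftProj χ (c * b) = 0 by simpa using this 1
    induction hb using Submodule.span_induction with
    | mem x hx =>
      obtain ⟨l, rfl⟩ := hx
      intro c
      rw [mul_sub, map_sub, 𝒜.leftProj_mul hχ, mul_smul_comm, _root_.mul_one, map_smul, sub_self]
    | zero => simp
    | add x y _ _ hx hy => intro c; rw [mul_add, map_add, hx, hy, add_zero]
    | smul r x _ hx => intro c; rw [smul_eq_mul, ← mul_assoc, hx]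
  · intro hb
    rw [← toLeft_leftProj, hb]
    exact congrArg _ (TensorProduct.zero_tmul A (1 : L))

lemma toLeft_bijective (hχ : D.IsInvariantCharacter χ) : Function.Bijective (𝒜.toLeft χ) := by
  constructor
  · intro a b hab
    have h : (Submodule.Quotient.mk (Smash.mk 𝒜 a 1 - Smash.mk 𝒜 b 1) : 𝒜.LeftInduced χ) = 0 :=
      sub_eq_zero.2 hab
    rwa [𝒜.quotient_mk_eq_zero_iff hχ, map_sub, leftProj_mk, leftProj_mk, hχ.map_one, one_smul,
      one_smul, sub_eq_zero] at h
  · intro x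
    obtain ⟨b, rfl⟩ := Submodule.Quotient.mk_surjective _ x
    exact ⟨_, 𝒜.toLeft_leftProj b⟩

lemma toLeft_add (a b : A) : 𝒜.toLeft χ (a + b) = 𝒜.toLeft χ a + 𝒜.toLeft χ b := by
  rw [toLeft, mk_add]
  rfl

lemma toLeft_smul (c : k) (a : A) : 𝒜.toLeft χ (c • a) = c • 𝒜.toLeft χ a := rfl

lemma mk_smul_toLeft (a b : A) : Smash.mk 𝒜 a 1 • 𝒜.toLeft χ b = 𝒜.toLeft χ (𝒜.star χ a b) := by
  rw [← leftProj_mul_mk_one, toLeft_leftProj]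
  rfl

lemma mk_one_smul_toLeft (l : L) (a : A) :
    Smash.mk 𝒜 𝒜.one l • 𝒜.toLeft χ a = 𝒜.toLeft χ (D.iota χ l • a) := by
  rw [← leftProj_mk_one_mul, toLeft_leftProj]
  rfl

/-- Since `l` acts on `A ≃ A_χ` through `ι_χ(l)`, generators are the weight vectors of weight `χ`,
the possible images of the class of `1_A` under `B`-linear maps. -/
lemma mem_generators_iff_toLeft (hχ : D.IsInvariantCharacter χ) (c : A) :
    c ∈ D.generators χ A ↔ ∀ l, Smash.mk 𝒜 𝒜.one l • 𝒜.toLeft χ c = χ l • 𝒜.toLeft χ c := by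
  simp only [mk_one_smul_toLeft, ← toLeft_smul, (𝒜.toLeft_bijective hχ).1.eq_iff]
  rfl

lemma star_one (hχ : D.IsInvariantCharacter χ) (a : A) : 𝒜.star χ a 𝒜.one = a := by
  rw [star_apply, 𝒜.mul_one, evalRight_tmul, hχ.map_one, one_smul]

lemma one_star (hχ : D.IsInvariantCharacter χ) (a : A) : 𝒜.star χ 𝒜.one a = a := by
  rw [star_apply, 𝒜.one_mul, evalRight_tmul, hχ.map_one, one_smul]

lemma leftEnd_ext (hχ : D.IsInvariantCharacter χ) {f g : Module.End 𝒜.Smash (𝒜.LeftInduced χ)}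
    (h : ∀ a, f (𝒜.toLeft χ a) = g (𝒜.toLeft χ a)) : f = g := by
  refine LinearMap.ext fun x => ?_
  obtain ⟨a, rfl⟩ := (𝒜.toLeft_bijective hχ).2 x
  exact h a

/-- The endomorphism of `A_χ` given by a `χ`-generator `c`, the right multiplication by `c`. -/
def leftEnd (hχ : D.IsInvariantCharacter χ) (c : D.generators χ A) :
    Module.End 𝒜.Smash (𝒜.LeftInduced χ) :=
  Submodule.mapQ _ _ (LinearMap.toSpanSingleton 𝒜.Smash 𝒜.Smash (Smash.mk 𝒜 c 1)) (by
    rw [Submodule.span_le]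
    rintro _ ⟨l, rfl⟩
    refine (Submodule.Quotient.mk_eq_zero (Submodule.span _ _)).1
      ((𝒜.quotient_mk_eq_zero_iff hχ _).2 ?_)
    rw [LinearMap.toSpanSingleton_apply, smul_eq_mul, sub_mul, map_sub, leftProj_mk_one_mul,
      smul_mul_assoc, _root_.one_mul, map_smul, leftProj_mk, hχ.map_one, one_smul, c.2 l, sub_self])

lemma leftEnd_toLeft (hχ : D.IsInvariantCharacter χ) (c : D.generators χ A) (a : A) :
    𝒜.leftEnd hχ c (𝒜.toLeft χ a) = 𝒜.toLeft χ (𝒜.star χ a c) :=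
  𝒜.mk_smul_toLeft a c

/-- This is `B`-linearity of right multiplication by `c`; only the last factor has to be a
generator. -/
lemma star_assoc (hχ : D.IsInvariantCharacter χ) (a b : A) (c : D.generators χ A) :
    𝒜.star χ (𝒜.star χ a b) c = 𝒜.star χ a (𝒜.star χ b c) := by
  refine (𝒜.toLeft_bijective hχ).1 ?_
  rw [← 𝒜.leftEnd_toLeft hχ, ← mk_smul_toLeft, map_smul, leftEnd_toLeft, mk_smul_toLeft]

lemma exists_leftEnd_eq [FiniteDimensional k H] (hχ : D.IsInvariantCharacter χ)
    (f : Module.End 𝒜.Smash (𝒜.LeftInduced χ)) : ∃ c, 𝒜.leftEnd hχ c = f := by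
  obtain ⟨c, hc⟩ := (𝒜.toLeft_bijective hχ).2 (f (𝒜.toLeft χ 𝒜.one))
  have hmem : c ∈ D.generators χ A := by
    rw [𝒜.mem_generators_iff_toLeft hχ]
    intro l
    rw [hc, ← map_smul, (𝒜.mem_generators_iff_toLeft hχ _).1 (𝒜.one_mem_generators hχ),
      LinearMap.map_smul_of_tower]
  refine ⟨⟨c, hmem⟩, 𝒜.leftEnd_ext hχ fun a => ?_⟩
  rw [leftEnd_toLeft, ← mk_smul_toLeft, hc, ← map_smul, mk_smul_toLeft, 𝒜.star_one hχ]

/-- A `B`-linear endomorphism carries weight vectors to weight vectors of the same weight. -/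
lemma star_mem_generators (hχ : D.IsInvariantCharacter χ) (b c : D.generators χ A) :
    𝒜.star χ b c ∈ D.generators χ A := by
  rw [𝒜.mem_generators_iff_toLeft hχ]
  intro l
  rw [← 𝒜.leftEnd_toLeft hχ, ← map_smul, (𝒜.mem_generators_iff_toLeft hχ _).1 b.2,
    LinearMap.map_smul_of_tower]

end LeftModule

/-! ### The right module induced from the adjoint character. -/

section RightModule

variable [FiniteDimensional k H]

/-- The projection `B → A`, `l a ↦ ψ(l) a`. -/
def rightProj (ψ : L →ₗ[k] k) : 𝒜.Smash →ₗ[k] A := 𝒜.evalLeft ψ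

variable {ψ : L →ₗ[k] k}

variable {𝒜} in
@[elab_as_elim]
-- The factorization `B = L A`: invertibility of the antipode makes the permutation `L ⊗ A → A ⊗ L`
-- onto.
lemma smash_induction_right {p : 𝒜.Smash → Prop} (b : 𝒜.Smash) (zero : p 0)
    (mk : ∀ l a, p (Smash.mk 𝒜 𝒜.one l * Smash.mk 𝒜 a 1)) (add : ∀ x y, p x → p y → p (x + y)) :
      p b := by
  obtain ⟨z, rfl⟩ : ∃ z, D.braid A z = b := ⟨_, 𝒜.braid_toLA b⟩
  induction z with
  | zero => rw [map_zero]; exact zero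
  | add x y hx hy => rw [map_add]; exact add _ _ hx hy
  | tmul l a => rw [← mk_one_mul_mk]; exact mk l a

lemma rightProj_mk_one_mul (l : L) (a : A) :
    𝒜.rightProj ψ (Smash.mk 𝒜 𝒜.one l * Smash.mk 𝒜 a 1) = ψ l • a := by
  rw [mk_one_mul_mk]
  exact 𝒜.evalLeft_braid ψ l a

lemma rightProj_mk (hψ : D.IsInvariantCharacter ψ) (a : A) :
    𝒜.rightProj ψ (Smash.mk 𝒜 a 1) = a := by
  simpa [mk_one_one, hψ.map_one] using 𝒜.rightProj_mk_one_mul (ψ := ψ) 1 a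

lemma rightProj_mul (hψ : D.IsInvariantCharacter ψ) (l : L) (b : 𝒜.Smash) :
    𝒜.rightProj ψ (Smash.mk 𝒜 𝒜.one l * b) = ψ l • 𝒜.rightProj ψ b := by
  induction b using smash_induction_right with
  | zero => simp
  | add x y hx hy => rw [mul_add, map_add, map_add, hx, hy, smul_add]
  | mk m a =>
    have h : Smash.mk 𝒜 𝒜.one l * Smash.mk 𝒜 𝒜.one m = Smash.mk 𝒜 𝒜.one (l * m) := by
      rw [mul_mk_one]
      exact absorb_tmul k L A 𝒜.one l m
    rw [← mul_assoc, h, rightProj_mk_one_mul, rightProj_mk_one_mul, hψ.map_mul, mul_smul]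

omit [FiniteDimensional k H] in
lemma rightProj_mk_mul_mk (a b : A) : 𝒜.rightProj ψ (Smash.mk 𝒜 a 1 * Smash.mk 𝒜 b 1) =
      𝒜.rdot ψ a b := by
  rw [mk_mul_mk_one]
  rfl

lemma toRight_rightProj (b : 𝒜.Smash) :
    𝒜.toRight ψ (𝒜.rightProj ψ b) = Submodule.Quotient.mk b := by
  induction b using smash_induction_right with
  | zero =>
    rw [map_zero]
    exact congrArg _ (TensorProduct.zero_tmul A (1 : L))
  | add x y hx hy =>
    rw [map_add, toRight, mk_add, Submodule.Quotient.mk_add, Submodule.Quotient.mk_add, ← hx, ← hy]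
    rfl
  | mk l a =>
    refine ((Submodule.Quotient.eq _).2 ?_).symm
    have h : Smash.mk 𝒜 𝒜.one l * Smash.mk 𝒜 a 1 -
        Smash.mk 𝒜 (𝒜.rightProj ψ (Smash.mk 𝒜 𝒜.one l * Smash.mk 𝒜 a 1)) 1 =
        MulOpposite.op (Smash.mk 𝒜 a 1) • (Smash.mk 𝒜 𝒜.one l - ψ l • (1 : 𝒜.Smash)) := by
      rw [rightProj_mk_one_mul, mk_smul, op_smul_eq_mul, sub_mul, smul_mul_assoc, _root_.one_mul]
    rw [h]
    exact Submodule.smul_mem _ _ (Submodule.subset_span ⟨l, rfl⟩)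

lemma quotient_mk_right_eq_zero_iff (hψ : D.IsInvariantCharacter ψ) (b : 𝒜.Smash) :
    (Submodule.Quotient.mk b : 𝒜.RightInduced ψ) = 0 ↔ 𝒜.rightProj ψ b = 0 := by
  constructor
  · intro hb
    rw [Submodule.Quotient.mk_eq_zero] at hb
    suffices ∀ c : 𝒜.Smash, 𝒜.rightProj ψ (b * c) = 0 by simpa using this 1
    induction hb using Submodule.span_induction with
    | mem x hx =>
      obtain ⟨l, rfl⟩ := hx
      intro c
      rw [sub_mul, map_sub, 𝒜.rightProj_mul hψ, smul_mul_assoc, _root_.one_mul, map_smul, sub_self]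
    | zero => simp
    | add x y _ _ hx hy => intro c; rw [add_mul, map_add, hx, hy, add_zero]
    | smul r x _ hx => intro c; rw [MulOpposite.smul_eq_mul_unop, mul_assoc, hx]
  · intro hb
    rw [← toRight_rightProj, hb]
    exact congrArg _ (TensorProduct.zero_tmul A (1 : L))

lemma toRight_bijective (hψ : D.IsInvariantCharacter ψ) : Function.Bijective (𝒜.toRight ψ) := by
  constructor
  · intro a b hab
    have h : (Submodule.Quotient.mk (Smash.mk 𝒜 a 1 - Smash.mk 𝒜 b 1) : 𝒜.RightInduced ψ) = 0 :=
      sub_eq_zero.2 hab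
    rwa [𝒜.quotient_mk_right_eq_zero_iff hψ, map_sub, 𝒜.rightProj_mk hψ, 𝒜.rightProj_mk hψ,
      sub_eq_zero] at h
  · intro x
    obtain ⟨b, rfl⟩ := Submodule.Quotient.mk_surjective _ x
    exact ⟨_, 𝒜.toRight_rightProj b⟩

omit [FiniteDimensional k H] in
lemma toRight_add (a b : A) : 𝒜.toRight ψ (a + b) = 𝒜.toRight ψ a + 𝒜.toRight ψ b := by
  rw [toRight, mk_add]
  rfl

omit [FiniteDimensional k H] in
lemma toRight_smul (c : k) (a : A) : 𝒜.toRight ψ (c • a) = c • 𝒜.toRight ψ a := rfl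

lemma mk_smul_toRight (a b : A) :
    MulOpposite.op (Smash.mk 𝒜 b 1) • 𝒜.toRight ψ a = 𝒜.toRight ψ (𝒜.rdot ψ a b) := by
  rw [← rightProj_mk_mul_mk, toRight_rightProj]
  rfl

/-- The passage from `A L` to `L A` contributes `γ̄`, which cancels one antipode of `ι_χ̃ = γ² ι_χ
ϑ̄`. -/
lemma rightProj_mk_adjoint (hχ : D.IsInvariantCharacter χ) (a : A) (l : L) :
    𝒜.rightProj (D.adjointChar χ) (Smash.mk 𝒜 a l) =
      antipode k (D.iota χ (D.drinfeldInv l)) • a := by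
  refine (𝒜.evalLeft_tmul _ a l).trans ?_
  rw [iota_adjointChar hχ, antipodeInv_antipode]

lemma mk_one_smul_toRight (hχ : D.IsInvariantCharacter χ) (l : L) (a : A) :
    MulOpposite.op (Smash.mk 𝒜 𝒜.one l) • 𝒜.toRight (D.adjointChar χ) a =
      𝒜.toRight (D.adjointChar χ) (antipode k (D.iota χ (D.drinfeldInv l)) • a) := by
  rw [← 𝒜.rightProj_mk_adjoint hχ, toRight_rightProj]
  exact congrArg _ (𝒜.mk_mul_one a l)

/-- The same vectors of `A` have weight `χ` in the left module and weight `χ̃` in the right one;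
this is why a single algebra governs both endomorphism rings. -/
lemma mem_generators_iff_toRight (hχ : D.IsInvariantCharacter χ) (c : A) :
    c ∈ D.generators χ A ↔ ∀ l, MulOpposite.op (Smash.mk 𝒜 𝒜.one l) •
      𝒜.toRight (D.adjointChar χ) c =
      D.adjointChar χ l • 𝒜.toRight (D.adjointChar χ) c := by
  simp only [𝒜.mk_one_smul_toRight hχ, ← toRight_smul,
    (𝒜.toRight_bijective (isInvariantCharacter_adjointChar hχ)).1.eq_iff,
    mem_generators_iff_adjoint]

lemma one_rdot (hψ : D.IsInvariantCharacter ψ) (a : A) : 𝒜.rdot ψ 𝒜.one a = a := by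
  rw [← rightProj_mk_mul_mk, mk_one_one, _root_.one_mul, 𝒜.rightProj_mk hψ]

lemma rightEnd_ext (hψ : D.IsInvariantCharacter ψ)
    {f g : Module.End 𝒜.Smashᵐᵒᵖ (𝒜.RightInduced ψ)}
    (h : ∀ a, f (𝒜.toRight ψ a) = g (𝒜.toRight ψ a)) : f = g := by
  refine LinearMap.ext fun x => ?_
  obtain ⟨a, rfl⟩ := (𝒜.toRight_bijective hψ).2 x
  exact h a

/-- The endomorphism of the right module induced from the adjoint character given by a
`χ`-generator `c`, the left multiplication by `c`. -/
def rightEnd (hχ : D.IsInvariantCharacter χ) (c : D.generators χ A) :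
    Module.End 𝒜.Smashᵐᵒᵖ (𝒜.RightInduced (D.adjointChar χ)) :=
  Submodule.mapQ _ _ (LinearMap.mulLeft 𝒜.Smashᵐᵒᵖ (Smash.mk 𝒜 (c : A) 1)) (by
    rw [Submodule.span_le]
    rintro _ ⟨l, rfl⟩
    refine (Submodule.Quotient.mk_eq_zero (Submodule.span _ _)).1
      ((𝒜.quotient_mk_right_eq_zero_iff (isInvariantCharacter_adjointChar hχ) _).2 ?_)
    rw [LinearMap.mulLeft_apply, mul_sub, map_sub, mk_mul_one, 𝒜.rightProj_mk_adjoint hχ,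
      mul_smul_comm, _root_.mul_one, map_smul,
      𝒜.rightProj_mk (isInvariantCharacter_adjointChar hχ),
      (mem_generators_iff_adjoint _).1 c.2 l, sub_self])

lemma rightEnd_toRight (hχ : D.IsInvariantCharacter χ) (c : D.generators χ A) (a : A) :
    𝒜.rightEnd hχ c (𝒜.toRight (D.adjointChar χ) a) =
      𝒜.toRight (D.adjointChar χ) (𝒜.rdot (D.adjointChar χ) c a) :=
  𝒜.mk_smul_toRight c a

lemma rdot_assoc (hχ : D.IsInvariantCharacter χ) (c : D.generators χ A) (a b : A) :
    𝒜.rdot (D.adjointChar χ) (𝒜.rdot (D.adjointChar χ) c a) b =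
      𝒜.rdot (D.adjointChar χ) c (𝒜.rdot (D.adjointChar χ) a b) := by
  refine (𝒜.toRight_bijective (isInvariantCharacter_adjointChar hχ)).1 ?_
  rw [← mk_smul_toRight, ← 𝒜.rightEnd_toRight hχ, ← 𝒜.rightEnd_toRight hχ, ← map_smul,
    mk_smul_toRight]

lemma exists_rightEnd_eq (hχ : D.IsInvariantCharacter χ)
    (f : Module.End 𝒜.Smashᵐᵒᵖ (𝒜.RightInduced (D.adjointChar χ))) :
    ∃ c, 𝒜.rightEnd hχ c = f := by
  have hψ := isInvariantCharacter_adjointChar hχ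
  obtain ⟨c, hc⟩ := (𝒜.toRight_bijective hψ).2 (f (𝒜.toRight _ 𝒜.one))
  have hmem : c ∈ D.generators χ A := by
    rw [𝒜.mem_generators_iff_toRight hχ]
    intro l
    rw [hc, ← map_smul, (𝒜.mem_generators_iff_toRight hχ _).1 (𝒜.one_mem_generators hχ),
      LinearMap.map_smul_of_tower]
  refine ⟨⟨c, hmem⟩, 𝒜.rightEnd_ext hψ fun a => ?_⟩
  rw [rightEnd_toRight, ← mk_smul_toRight, hc, ← map_smul, mk_smul_toRight, 𝒜.one_rdot hψ]

/-- On generators the two products agree, so the module axiom is associativity of the second product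
with a generator as first factor. -/
lemma star_rdot (hχ : D.IsInvariantCharacter χ) (b c : D.generators χ A) (a : A) :
    𝒜.rdot (D.adjointChar χ) (𝒜.star χ b c) a =
      𝒜.rdot (D.adjointChar χ) b (𝒜.rdot (D.adjointChar χ) c a) := by
  rw [𝒜.star_eq_rdot hχ b.2 c.2, 𝒜.rdot_assoc hχ]

end RightModule

/-! ### The algebra of generators and the two isomorphisms. -/

section EndomorphismAlgebras

variable [FiniteDimensional k H]

lemma isHAlgebraOn_generators (hχ : D.IsInvariantCharacter χ) :
    IsHAlgebraOn k H (𝒜.star χ) 𝒜.one (D.generators χ A) where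
  op_mem a ha b hb := 𝒜.star_mem_generators hχ ⟨a, ha⟩ ⟨b, hb⟩
  unit_mem := 𝒜.one_mem_generators hχ
  op_assoc a _ b _ c hc := 𝒜.star_assoc hχ a b ⟨c, hc⟩
  unit_op a _ := 𝒜.one_star hχ a
  op_unit a _ := 𝒜.star_one hχ a
  smul_mem h _ ha := smul_mem_generators hχ ha h
  smul_op h a _ b _ := 𝒜.smul_star hχ h a b
  smul_unit := 𝒜.smul_one_eq hχ

omit [FiniteDimensional k H] in
lemma leftEnd_add (hχ : D.IsInvariantCharacter χ) (c d : D.generators χ A) :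
    𝒜.leftEnd hχ (c + d) = 𝒜.leftEnd hχ c + 𝒜.leftEnd hχ d :=
  𝒜.leftEnd_ext hχ fun a => by
    rw [LinearMap.add_apply, leftEnd_toLeft, leftEnd_toLeft, leftEnd_toLeft, ← toLeft_add,
      ← map_add]
    rfl

omit [FiniteDimensional k H] in
lemma leftEnd_smul (hχ : D.IsInvariantCharacter χ) (r : k) (c : D.generators χ A) :
    𝒜.leftEnd hχ (r • c) = r • 𝒜.leftEnd hχ c :=
  𝒜.leftEnd_ext hχ fun a => by
    rw [LinearMap.smul_apply, leftEnd_toLeft, leftEnd_toLeft, ← toLeft_smul, ← map_smul]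
    rfl

omit [FiniteDimensional k H] in
lemma leftEnd_star (hχ : D.IsInvariantCharacter χ) (c d : D.generators χ A) :
    𝒜.leftEnd hχ ⟨𝒜.star χ d c, 𝒜.star_mem_generators hχ d c⟩ =
      𝒜.leftEnd hχ c * 𝒜.leftEnd hχ d :=
  𝒜.leftEnd_ext hχ fun a => by
    rw [Module.End.mul_apply, leftEnd_toLeft, leftEnd_toLeft, leftEnd_toLeft, 𝒜.star_assoc hχ]

lemma rightEnd_add (hχ : D.IsInvariantCharacter χ) (c d : D.generators χ A) :
    𝒜.rightEnd hχ (c + d) = 𝒜.rightEnd hχ c + 𝒜.rightEnd hχ d :=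
  𝒜.rightEnd_ext (isInvariantCharacter_adjointChar hχ) fun a => by
    rw [LinearMap.add_apply, rightEnd_toRight, rightEnd_toRight, rightEnd_toRight, ← toRight_add,
      ← LinearMap.add_apply, ← map_add]
    rfl

lemma rightEnd_smul (hχ : D.IsInvariantCharacter χ) (r : k) (c : D.generators χ A) :
    𝒜.rightEnd hχ (r • c) = r • 𝒜.rightEnd hχ c :=
  𝒜.rightEnd_ext (isInvariantCharacter_adjointChar hχ) fun a => by
    rw [LinearMap.smul_apply, rightEnd_toRight, rightEnd_toRight, ← toRight_smul,
      ← LinearMap.smul_apply, ← map_smul]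
    rfl

/-- Left multiplications compose in the order of the product, while right multiplications reverse
it; hence the opposite endomorphism algebra on this side. -/
lemma rightEnd_star (hχ : D.IsInvariantCharacter χ) (c d : D.generators χ A) :
    𝒜.rightEnd hχ ⟨𝒜.star χ d c, 𝒜.star_mem_generators hχ d c⟩ =
      𝒜.rightEnd hχ d * 𝒜.rightEnd hχ c :=
  𝒜.rightEnd_ext (isInvariantCharacter_adjointChar hχ) fun a => by
    rw [Module.End.mul_apply, rightEnd_toRight, rightEnd_toRight, rightEnd_toRight,
      𝒜.star_rdot hχ]

/-- The opposite of the algebra of `χ`-generators acts on `A_χ`. -/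
def leftEndHom (hχ : D.IsInvariantCharacter χ)
    (hG : IsHAlgebraOn k H (𝒜.star χ) 𝒜.one (D.generators χ A)) :
    (hG.Alg)ᵐᵒᵖ →ₐ[k] Module.End 𝒜.Smash (𝒜.LeftInduced χ) :=
  AlgHom.ofLinearMap
    { toFun := fun c => 𝒜.leftEnd hχ c.unop
      map_add' := fun c d => 𝒜.leftEnd_add hχ c.unop d.unop
      map_smul' := fun r c => 𝒜.leftEnd_smul hχ r c.unop }
    (𝒜.leftEnd_ext hχ fun a =>
      (𝒜.leftEnd_toLeft hχ _ a).trans (congrArg _ (𝒜.star_one hχ a)))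
    (fun c d => 𝒜.leftEnd_star hχ c.unop d.unop)

/-- The opposite of the algebra of `χ`-generators acts on the right module induced from the
adjoint character by right operators. -/
def rightEndHom (hχ : D.IsInvariantCharacter χ)
    (hG : IsHAlgebraOn k H (𝒜.star χ) 𝒜.one (D.generators χ A)) :
    (hG.Alg)ᵐᵒᵖ →ₐ[k] (Module.End 𝒜.Smashᵐᵒᵖ (𝒜.RightInduced (D.adjointChar χ)))ᵐᵒᵖ :=
  AlgHom.ofLinearMap
    { toFun := fun c => MulOpposite.op (𝒜.rightEnd hχ c.unop)
      map_add' := fun c d => congrArg MulOpposite.op (𝒜.rightEnd_add hχ c.unop d.unop)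
      map_smul' := fun r c => congrArg MulOpposite.op (𝒜.rightEnd_smul hχ r c.unop) }
    (congrArg MulOpposite.op <| 𝒜.rightEnd_ext (isInvariantCharacter_adjointChar hχ) fun a =>
      (𝒜.rightEnd_toRight hχ _ a).trans
        (congrArg _ (𝒜.one_rdot (isInvariantCharacter_adjointChar hχ) a)))
    (fun c d => congrArg MulOpposite.op (𝒜.rightEnd_star hχ c.unop d.unop))

lemma leftEndHom_bijective (hχ : D.IsInvariantCharacter χ)
    (hG : IsHAlgebraOn k H (𝒜.star χ) 𝒜.one (D.generators χ A)) :
    Function.Bijective (𝒜.leftEndHom hχ hG) := by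
  constructor
  · intro c d hcd
    have h := (𝒜.toLeft_bijective hχ).1 (((𝒜.leftEnd_toLeft hχ _ 𝒜.one).symm.trans
      (LinearMap.congr_fun hcd (𝒜.toLeft χ 𝒜.one))).trans (𝒜.leftEnd_toLeft hχ _ 𝒜.one))
    rw [𝒜.one_star hχ, 𝒜.one_star hχ] at h
    exact MulOpposite.unop_injective (Subtype.ext h)
  · intro f
    obtain ⟨c, rfl⟩ := 𝒜.exists_leftEnd_eq hχ f
    exact ⟨MulOpposite.op (IsHAlgebraOn.Alg.mk hG c), rfl⟩

lemma rdot_one (hχ : D.IsInvariantCharacter χ) (c : D.generators χ A) :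
    𝒜.rdot (D.adjointChar χ) c 𝒜.one = c := by
  rw [← 𝒜.star_eq_rdot hχ c.2 (𝒜.one_mem_generators hχ), 𝒜.star_one hχ]

lemma rightEndHom_bijective (hχ : D.IsInvariantCharacter χ)
    (hG : IsHAlgebraOn k H (𝒜.star χ) 𝒜.one (D.generators χ A)) :
    Function.Bijective (𝒜.rightEndHom hχ hG) := by
  constructor
  · intro c d hcd
    have h := (𝒜.toRight_bijective (isInvariantCharacter_adjointChar hχ)).1
      (((𝒜.rightEnd_toRight hχ _ 𝒜.one).symm.trans (LinearMap.congr_fun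
        (congrArg MulOpposite.unop hcd) (𝒜.toRight _ 𝒜.one))).trans
        (𝒜.rightEnd_toRight hχ _ 𝒜.one))
    exact MulOpposite.unop_injective (Subtype.ext
      (((𝒜.rdot_one hχ c.unop).symm.trans h).trans (𝒜.rdot_one hχ d.unop)))
  · intro f
    obtain ⟨c, hc⟩ := 𝒜.exists_rightEnd_eq hχ f.unop
    exact ⟨MulOpposite.op (IsHAlgebraOn.Alg.mk hG c), MulOpposite.unop_injective hc⟩

end EndomorphismAlgebras

end DynAlgebra
end DynBase
end

theorem mainTheorem1 {k H L A : Type*} [Field k] [Ring H] [HopfAlgebra k H]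
    [FiniteDimensional k H]
    [Ring L] [Algebra k L] [Module H L] [IsScalarTower k H L] (D : DynBase.Base k H L)
    [AddCommGroup A] [Module k A] [Module H A] [IsScalarTower k H A]
    (𝒜 : DynBase.DynAlgebra D A) (χ : L →ₗ[k] k) (hχ : D.IsInvariantCharacter χ) :
    -- the adjoint of `χ` is an invariant character
    D.IsInvariantCharacter (D.adjointChar χ) ∧
    -- `A` is identified with the two induced modules, and the two operations on `A`
    -- are the restrictions to `A ⊂ B` of the actions of `B`
    Function.Bijective (𝒜.toLeft χ) ∧
    Function.Bijective (𝒜.toRight (D.adjointChar χ)) ∧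
    (∀ a b : A, DynBase.DynAlgebra.Smash.mk 𝒜 a 1 • 𝒜.toLeft χ b = 𝒜.toLeft χ (𝒜.star χ a b)) ∧
    (∀ a b : A, MulOpposite.op (DynBase.DynAlgebra.Smash.mk 𝒜 b 1) •
        𝒜.toRight (D.adjointChar χ) a =
      𝒜.toRight (D.adjointChar χ) (𝒜.rdot (D.adjointChar χ) a b)) ∧
    -- the two operations coincide on the space of `χ`-generators
    (∀ a ∈ D.generators χ A, ∀ b ∈ D.generators χ A,
      𝒜.star χ a b = 𝒜.rdot (D.adjointChar χ) a b) ∧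
    -- the space of `χ`-generators is an associative `H`-algebra
    ∃ hG : DynBase.IsHAlgebraOn k H (𝒜.star χ) 𝒜.one (D.generators χ A),
      -- `A` is a right module over it
      (∀ a : A, 𝒜.star χ a 𝒜.one = a) ∧
      (∀ a : A, ∀ b ∈ D.generators χ A, ∀ c ∈ D.generators χ A,
        𝒜.star χ (𝒜.star χ a b) c = 𝒜.star χ a (𝒜.star χ b c)) ∧
      -- `A` is a left module over it
      (∀ a : A, 𝒜.rdot (D.adjointChar χ) 𝒜.one a = a) ∧
      (∀ b ∈ D.generators χ A, ∀ c ∈ D.generators χ A, ∀ a : A,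
        𝒜.rdot (D.adjointChar χ) (𝒜.star χ b c) a =
          𝒜.rdot (D.adjointChar χ) b (𝒜.rdot (D.adjointChar χ) c a)) ∧
      -- `End_B(A_χ)` is the opposite algebra, acting by right multiplications
      (∃ Φ : (hG.Alg)ᵐᵒᵖ ≃ₐ[k] Module.End 𝒜.Smash (𝒜.LeftInduced χ),
        ∀ (c : D.generators χ A) (a : A),
          Φ (MulOpposite.op (DynBase.IsHAlgebraOn.Alg.mk hG c)) (𝒜.toLeft χ a) =
            𝒜.toLeft χ (𝒜.star χ a c)) ∧
      -- it is also the algebra of endomorphisms of the right module, composed as right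
      -- operators; it acts by left multiplications
      (∃ Ψ : (hG.Alg)ᵐᵒᵖ ≃ₐ[k]
          (Module.End (𝒜.Smash)ᵐᵒᵖ (𝒜.RightInduced (D.adjointChar χ)))ᵐᵒᵖ,
        ∀ (c : D.generators χ A) (a : A),
          (Ψ (MulOpposite.op (DynBase.IsHAlgebraOn.Alg.mk hG c))).unop
              (𝒜.toRight (D.adjointChar χ) a) =
            𝒜.toRight (D.adjointChar χ) (𝒜.rdot (D.adjointChar χ) c a)) := by
  have hψ := DynBase.Base.isInvariantCharacter_adjointChar hχ
  have hG := 𝒜.isHAlgebraOn_generators hχ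
  refine ⟨hψ, 𝒜.toLeft_bijective hχ, 𝒜.toRight_bijective hψ, 𝒜.mk_smul_toLeft, 𝒜.mk_smul_toRight,
    fun a ha b hb => 𝒜.star_eq_rdot hχ ha hb, hG, 𝒜.star_one hχ,
    fun a b _ c hc => 𝒜.star_assoc hχ a b ⟨c, hc⟩, 𝒜.one_rdot hψ,
    fun b hb c hc a => 𝒜.star_rdot hχ ⟨b, hb⟩ ⟨c, hc⟩ a,
    ⟨AlgEquiv.ofBijective (𝒜.leftEndHom hχ hG) (𝒜.leftEndHom_bijective hχ hG), fun c a => ?_⟩,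
    ⟨AlgEquiv.ofBijective (𝒜.rightEndHom hχ hG) (𝒜.rightEndHom_bijective hχ hG), fun c a => ?_⟩⟩
  · exact 𝒜.leftEnd_toLeft hχ c a
  · exact 𝒜.rightEnd_toRight hχ c a
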